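/- **Model.** $\mathit{CAMP}_{n,t}[\emptyset]$ consists of $n$ sequential asynchronous processes $p_1,\dots,p_n$, of which at most $t$ may crash (a crash is a definitive halt; a process that never crashes is correct, and then takes infinitely many steps). They execute deterministic automata; in one computation step a process sends at most one point-to-point message. Channels do not create, corrupt, duplicate or lose messages, but transit delays are finite and arbitrary. An object is *solvable in $\mathit{CAMP}_{n,t}[\emptyset]$* if some algorithm guarantees, in all its executions, that every operation invoked by a correct process terminates and that the specification of the object holds. **Money transfer.** Initial accounts $\mathrm{init}[j]\ge 0$ are known to all. A process $p_i$ can invoke $\mathrm{balance}(j)$, which returns a value, and $\mathrm{transfer}(j,v)$ with $j\ne i$ and $v\ge 0$, which returns commit or abort. The history $H=(L_1,\dots,L_n)$ of an execution consists of the sequences of operations issued by the processes; an operation of a crashed process that never returned either is left out or is considered to have taken effect with some result. Let $A_i(H)$ be obtained from $H$ by keeping $L_i$ and keeping only the committed transfers in $L_j$, $j\neq i$. A serialization of a history is a finite or infinite sequence (of order type at most $\omega$) that contains each operation of the history exactly once and respects the order of the operations of each process. It is MT-compliant if, with $\mathrm{acc}(j)$ denoting $\mathrm{init}[j]$ plus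 the money transferred to $p_j$ minus the money transferred by $p_j$ in committed transfers that stand earlier in the sequence, (a) $v\le \mathrm{acc}(j)$ at each committed transfer of an amount $v$ by $p_j$, (b) $v>\mathrm{acc}(j)$ at each aborted one, and (c) each $\mathrm{balance}(j)$ in it returns $\mathrm{acc}(j)$. The specification is that an execution has a history $H$ such that, for each correct $p_i$, $A_i(H)$ has an MT-compliant serialization, and, for each faulty $p_i$, $A_i(H')$ has one for some $H'=(L'_1,\dots,L'_n)$ with $L'_i=L_i$ and $L'_j$ a prefix of $L_j$ for $j\ne i$. Money transfer is solvable if it is solvable for each non-negative array $\mathrm{init}$. **Registers.** A register holds values of a set $V$ with at least two elements and has an initial value $v_0\in V$; all processes can read it. A *safe* register has one writer, and a read that is not concurrent with a write returns the last written value ($v_0$ if there is none). A *regular* register has one writer, and each read returns the last value whose write ended before the read started ($v_0$ if there is none) or a value whose write is concurrent with the read. An *atomic* register (with one or several writers) is linearizable. **Theorem.** 1. For all $n$ and $t<n$, money transfer is solvable in $\mathit{CAMP}_{n,t}[\emptyset]$. 2. For all $n$ and $t<n$, each $V$ with at least two elements and each $v_0\in V$: for every choice of the writer $p_w$, a single-writer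 safe (respectively regular, atomic) register is solvable in $\mathit{CAMP}_{n,t}[\emptyset]$ if and only if $t<n/2$; and for every non-empty set of writers, the atomic register that they can write is solvable in $\mathit{CAMP}_{n,t}[\emptyset]$ if and only if $t<n/2$. 3. Consequently money transfer is strictly weaker than each of these single-writer registers: it is solvable in $\mathit{CAMP}_{n,t}[\emptyset]$ whenever the register is solvable for some choice of the writer, and there are $n$ and $t<n$ for which money transfer is solvable while the register is solvable for no choice of the writer. -/

import Mathlib

namespace CAMP

/-! ### Crash-prone asynchronous message-passing systems -/

/-- A deterministic distributed algorithm for processes `p_0, …, p_{n-1}` that offers its clients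
the operations `Inv` with results `Res`. A process is an automaton that reacts to the invocation
of an operation, to the reception of a message (whose sender it knows), and that takes
computation steps. In one computation step it sends at most one message (so that a process can
crash between any two sends of a broadcast) and possibly returns from its current operation. -/
structure Algorithm (n : ℕ) (Inv Res : Type) where
  State : Type
  Msg : Type
  start : Fin n → State
  invoke : Fin n → State → Inv → State
  receive : Fin n → State → Fin n → Msg → State
  compute : Fin n → State → State × Option (Fin n × Msg) × Option Res

/-- What happens in an event of a run; `receive s` is the reception of the message sent in the
`s`-th event. -/
inductive Action (Inv : Type) where
  | invoke (o : Inv)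
  | receive (s : ℕ)
  | compute

/-- What the clients see of an infinite run: in the `k`-th event, the process `proc k` takes a
step, in which it is asked to perform `inv k` or outputs the result `out k` (if these are not
`none`). -/
structure Trace (n : ℕ) (Inv Res : Type) where
  proc : ℕ → Fin n
  inv : ℕ → Option Inv
  out : ℕ → Option Res

namespace Trace

variable {n : ℕ} {Inv Res : Type}

/-- A process is faulty in a run if it halts (crashes) at some point. -/
def Faulty (T : Trace n Inv Res) (p : Fin n) : Prop := ∃ K, ∀ k, K ≤ k → T.proc k ≠ p

/-- A process that is not faulty is correct. -/
def Correct (T : Trace n Inv Res) (p : Fin n) : Prop := ¬ T.Faulty p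

/-- The operation invoked in event `k` returns `r` in event `l`: this is the first output of the
process after the invocation. (Outputs while no operation is pending have no effect.) -/
def Returns (T : Trace n Inv Res) (k l : ℕ) (r : Res) : Prop :=
  (T.inv k).isSome ∧ k < l ∧ T.proc l = T.proc k ∧ T.out l = some r ∧
    ∀ m, k < m → m < l → T.proc m = T.proc k → T.out m = none

/-- The operation invoked in event `k` returns before event `k'`. -/
def Precedes (T : Trace n Inv Res) (k k' : ℕ) : Prop := ∃ l r, T.Returns k l r ∧ l < k'

/-- All the operations invoked by correct processes terminate. -/
def Terminates (T : Trace n Inv Res) : Prop :=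
  ∀ k, (T.inv k).isSome → T.Correct (T.proc k) → ∃ l r, T.Returns k l r

/-- Clients respect the interface: process `p` only invokes operations `o` with `allowed p o`,
and processes are sequential, i.e. a process invokes an operation only after its previous
operation has returned. -/
def ProperUse (T : Trace n Inv Res) (allowed : Fin n → Inv → Prop) : Prop :=
  (∀ k o, T.inv k = some o → allowed (T.proc k) o) ∧
  ∀ k k', k < k' → T.proc k = T.proc k' → (T.inv k).isSome → (T.inv k').isSome →
    T.Precedes k k'

end Trace

/-- An infinite sequence of events together with the states of the processes:
`state k p` is the state of process `p` just before the `k`-th event. -/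
structure Run {n : ℕ} {Inv Res : Type} (A : Algorithm n Inv Res) where
  proc : ℕ → Fin n
  act : ℕ → Action Inv
  state : ℕ → Fin n → A.State

namespace Run

variable {n : ℕ} {Inv Res : Type} {A : Algorithm n Inv Res}

/-- The message (with its destination) sent in event `k`, if any. -/
def sent (R : Run A) (k : ℕ) : Option (Fin n × A.Msg) :=
  match R.act k with
  | .compute => (A.compute (R.proc k) (R.state k (R.proc k))).2.1
  | _ => none

/-- The external trace of a run. -/
def trace (R : Run A) : Trace n Inv Res where
  proc := R.proc
  inv k := match R.act k with
    | .invoke o => some o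
    | _ => none
  out k := match R.act k with
    | .compute => (A.compute (R.proc k) (R.state k (R.proc k))).2.2
    | _ => none

/-- Event `k` is a step of the algorithm: only the state of `proc k` changes, as prescribed by
the algorithm, and a received message was sent before to the receiving process. -/
def IsStep (R : Run A) (k : ℕ) : Prop :=
  match R.act k with
  | .invoke o => R.state (k + 1) =
      Function.update (R.state k) (R.proc k) (A.invoke (R.proc k) (R.state k (R.proc k)) o)
  | .receive s => s < k ∧ ∃ m, R.sent s = some (R.proc k, m) ∧ R.state (k + 1) =
      Function.update (R.state k) (R.proc k)
        (A.receive (R.proc k) (R.state k (R.proc k)) (R.proc s) m)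
  | .compute => R.state (k + 1) =
      Function.update (R.state k) (R.proc k) (A.compute (R.proc k) (R.state k (R.proc k))).1

/-- `R` is an execution of `A` in the crash-prone asynchronous message-passing model with at most
`t` faulty processes, in which the clients use the interface properly. Channels do not create,
corrupt, duplicate or lose messages; speeds and transit delays are finite but arbitrary. -/
structure IsExecution (R : Run A) (t : ℕ) (allowed : Fin n → Inv → Prop) : Prop where
  start : R.state 0 = A.start
  step : ∀ k, R.IsStep k
  properUse : R.trace.ProperUse allowed
  crashes : {p | R.trace.Faulty p}.ncard ≤ t
  progress : ∀ p, R.trace.Correct p → ∀ K, ∃ k, K ≤ k ∧ R.proc k = p ∧ R.act k = .compute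
  noDuplication : ∀ s k k', R.act k = .receive s → R.act k' = .receive s → k = k'
  noLoss : ∀ s q m, R.sent s = some (q, m) → R.trace.Correct q → ∃ k, R.act k = .receive s

end Run

/-- The object with operations `Inv`, results `Res`, rules of use `allowed` and safety
specification `spec` can be implemented among `n` processes of which at most `t` can crash: some
algorithm guarantees in all its executions that the operations invoked by correct processes
terminate, and that the specification holds. -/
def Solvable {Inv Res : Type} (n t : ℕ) (allowed : Fin n → Inv → Prop)
    (spec : Trace n Inv Res → Prop) : Prop :=
  ∃ A : Algorithm n Inv Res, ∀ R : Run A, R.IsExecution t allowed →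
    R.trace.Terminates ∧ spec R.trace

/-! ### Histories and serializations -/

/-- An operation of a history: who issued it, what it was, and its result. -/
structure Operation (n : ℕ) (Inv Res : Type) where
  proc : Fin n
  op : Inv
  res : Res

/-- A history; the operations are indexed by the event of their invocation. The local history of
a process is the (finite or infinite) sequence of its operations by increasing index. -/
abbrev History (n : ℕ) (Inv Res : Type) := ℕ → Option (Operation n Inv Res)

section

variable {n : ℕ} {Inv Res : Type}

/-- `H` is a history of the run with trace `T`. It contains all operations that returned. An
operation that is pending for ever (its process crashed) has either taken effect with some
result, or is left out. -/
def IsHistoryOf (H : History n Inv Res) (T : Trace n Inv Res) : Prop :=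
  (∀ k a, H k = some a → T.proc k = a.proc ∧ T.inv k = some a.op) ∧
  ∀ k l r, T.Returns k l r → ∃ a, H k = some a ∧ a.res = r

/-- Process order. -/
def ProcessOrder (H : History n Inv Res) (k k' : ℕ) : Prop :=
  k < k' ∧ ∃ a a', H k = some a ∧ H k' = some a' ∧ a.proc = a'.proc

/-- `S` is a sequence that contains (the indices of) all the operations of `H`, each exactly
once, and nothing else, and that respects the order `before`. Slots `none` are empty, so `S`
stands for a finite or infinite sequence. -/
def IsSerialization (H : History n Inv Res) (before : ℕ → ℕ → Prop) (S : ℕ → Option ℕ) : Prop :=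
  (∀ x k, S x = some k → (H k).isSome) ∧
  (∀ k, (H k).isSome → ∃! x, S x = some k) ∧
  ∀ x x' k k', S x = some k → S x' = some k' → before k k' → x < x'

end

/-! ### Money transfer -/

inductive MTOp (n : ℕ) where
  | balance (j : Fin n)
  | transfer (j : Fin n) (v : ℝ)

inductive MTRes where
  | value (v : ℝ)
  | commit
  | abort

/-- Transfers are of non-negative amounts, and to another process. -/
def mtAllowed {n : ℕ} (p : Fin n) : MTOp n → Prop
  | .balance _ => True
  | .transfer j v => j ≠ p ∧ 0 ≤ v

section

variable {n : ℕ}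

/-- Is this a (successful) transfer? -/
def Operation.isTransfer (a : Operation n (MTOp n) MTRes) : Bool :=
  match a.op, a.res with
  | .transfer _ _, .commit => true
  | _, _ => false

/-- The money given to `p_j` by an operation. -/
def Operation.plus (j : Fin n) (a : Operation n (MTOp n) MTRes) : ℝ :=
  match a.op, a.res with
  | .transfer k v, .commit => if k = j then v else 0
  | _, _ => 0

/-- The money given by `p_j` in an operation. -/
def Operation.minus (j : Fin n) (a : Operation n (MTOp n) MTRes) : ℝ :=
  match a.op, a.res with
  | .transfer _ v, .commit => if a.proc = j then v else 0
  | _, _ => 0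

/-- The history in which the local history of `p_i` is kept, and those of the other processes are
restricted to their transfers. -/
def viewOf (i : Fin n) (H : History n (MTOp n) MTRes) : History n (MTOp n) MTRes :=
  fun k => (H k).filter fun a => decide (a.proc = i) || a.isTransfer

/-- The value of the account of `p_j` according to the operations of `H` that stand in `S` before
position `x`. -/
noncomputable def acc (init : Fin n → ℝ) (H : History n (MTOp n) MTRes) (S : ℕ → Option ℕ)
    (j : Fin n) (x : ℕ) : ℝ :=
  init j + ∑ y ∈ Finset.range x, (((S y).bind H).elim 0 (Operation.plus j))
    - ∑ y ∈ Finset.range x, (((S y).bind H).elim 0 (Operation.minus j))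

/-- Money-transfer compliance: processes transfer only money that they have, a transfer aborts
only for lack of money, and balances are the current values of the accounts. -/
def MTCompliant (init : Fin n → ℝ) (H : History n (MTOp n) MTRes) (S : ℕ → Option ℕ) : Prop :=
  ∀ x k a, S x = some k → H k = some a →
    match a.op, a.res with
    | .transfer _ v, .commit => v ≤ acc init H S a.proc x
    | .transfer _ v, .abort => acc init H S a.proc x < v
    | .balance j, .value v => v = acc init H S j x
    | _, _ => False

/-- There is an MT-compliant serialization of the view of `p_i` on `H`. -/
def HasMTSerialization (init : Fin n → ℝ) (i : Fin n) (H : History n (MTOp n) MTRes) : Prop :=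
  ∃ S, IsSerialization (viewOf i H) (ProcessOrder (viewOf i H)) S ∧
    MTCompliant init (viewOf i H) S

/-- `H'` consists of the local history of `p_i` in `H` and of prefixes of the local histories of
the other processes. -/
def IsPrefixExcept (i : Fin n) (H' H : History n (MTOp n) MTRes) : Prop :=
  (∀ k a, H' k = some a → H k = some a) ∧
  (∀ k a, H k = some a → a.proc = i → H' k = some a) ∧
  ∀ k k', ProcessOrder H k k' → (H' k').isSome → (H' k).isSome

/-- The specification of the money-transfer object with initial accounts `init`. -/
def MTSpec (init : Fin n → ℝ) (T : Trace n (MTOp n) MTRes) : Prop :=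
  ∃ H, IsHistoryOf H T ∧
    (∀ i, T.Correct i → HasMTSerialization init i H) ∧
    ∀ i, T.Faulty i → ∃ H', IsPrefixExcept i H' H ∧ HasMTSerialization init i H'

end

/-- Money transfer is solvable among `n` processes of which at most `t` can crash. -/
def MoneyTransferSolvable (n t : ℕ) : Prop :=
  ∀ init : Fin n → ℝ, (∀ i, 0 ≤ init i) → Solvable n t mtAllowed (MTSpec init)

/-! ### Read/write registers -/

inductive RegOp (V : Type) where
  | read
  | write (v : V)

inductive RegRes (V : Type) where
  | value (v : V)
  | ack

inductive RegisterKind where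
  | safe
  | regular
  | atomic

section

variable {n : ℕ} {V : Type}

/-- All processes may read, the processes of `writers` may write. -/
def regAllowed (writers : Set (Fin n)) (p : Fin n) : RegOp V → Prop
  | .read => True
  | .write _ => p ∈ writers

/-- Reads return values, writes return acknowledgements. -/
def ResultsTyped (T : Trace n (RegOp V) (RegRes V)) : Prop :=
  ∀ k l r, T.Returns k l r →
    (T.inv k = some .read → ∃ v, r = .value v) ∧
    ∀ v, T.inv k = some (.write v) → r = .ack

/-- `v` is the value of the last write that precedes the operation `k`, or the initial value if
there is none. -/
def LastWritten (v₀ : V) (T : Trace n (RegOp V) (RegRes V)) (k : ℕ) (v : V) : Prop :=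
  (∃ w, T.inv w = some (.write v) ∧ T.Precedes w k ∧
    ∀ w' v', T.inv w' = some (.write v') → T.Precedes w' k → w' ≤ w) ∨
  (v = v₀ ∧ ∀ w v', T.inv w = some (.write v') → ¬ T.Precedes w k)

/-- The operations `k` and `k'` are concurrent. -/
def Concurrent (T : Trace n (RegOp V) (RegRes V)) (k k' : ℕ) : Prop :=
  ¬ T.Precedes k k' ∧ ¬ T.Precedes k' k

/-- Safe (single-writer) register: a read that is not concurrent with a write returns the last
written value; other reads return any value of the register. -/
def SafeSpec (v₀ : V) (T : Trace n (RegOp V) (RegRes V)) : Prop :=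
  ResultsTyped T ∧ ∀ k l v, T.inv k = some .read → T.Returns k l (.value v) →
    (∀ w v', T.inv w = some (.write v') → ¬ Concurrent T w k) → LastWritten v₀ T k v

/-- Regular (single-writer) register: a read returns the last written value or the value of a
concurrent write. -/
def RegularSpec (v₀ : V) (T : Trace n (RegOp V) (RegRes V)) : Prop :=
  ResultsTyped T ∧ ∀ k l v, T.inv k = some .read → T.Returns k l (.value v) →
    LastWritten v₀ T k v ∨ ∃ w, T.inv w = some (.write v) ∧ Concurrent T w k

/-- The value of a sequential register after the operations that stand in `S` before
position `x`. -/
def regValue (v₀ : V) (H : History n (RegOp V) (RegRes V)) (S : ℕ → Option ℕ) : ℕ → V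
  | 0 => v₀
  | x + 1 =>
    match (S x).bind H with
    | some ⟨_, .write v, _⟩ => v
    | _ => regValue v₀ H S x

/-- The sequence `S` of operations of `H` is legal for a sequential register. -/
def RegLegal (v₀ : V) (H : History n (RegOp V) (RegRes V)) (S : ℕ → Option ℕ) : Prop :=
  ∀ x k a, S x = some k → H k = some a →
    match a.op, a.res with
    | .read, .value v => v = regValue v₀ H S x
    | .write _, .ack => True
    | _, _ => False

/-- Atomic register: linearizability. -/
def AtomicSpec (v₀ : V) (T : Trace n (RegOp V) (RegRes V)) : Prop :=
  ∃ H, IsHistoryOf H T ∧ ∃ S, IsSerialization H T.Precedes S ∧ RegLegal v₀ H S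

def RegisterSpec (κ : RegisterKind) (v₀ : V) : Trace n (RegOp V) (RegRes V) → Prop :=
  match κ with
  | .safe => SafeSpec v₀
  | .regular => RegularSpec v₀
  | .atomic => AtomicSpec v₀

end

/-- A register of the given kind with initial value `v₀`, that all processes can read and those in
`writers` can write, can be built among `n` processes of which at most `t` can crash. -/
def RegisterSolvable {V : Type} (κ : RegisterKind) (v₀ : V) (n t : ℕ) (writers : Set (Fin n)) :
    Prop :=
  Solvable n t (regAllowed writers) (RegisterSpec κ v₀)

/-- Problem `P` is strictly weaker than problem `Q` in the crash model: `P` is solvable whenever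
`Q` is, for some number of processes and of crashes `P` is solvable but `Q` is not. -/
def StrictlyWeaker (P Q : ℕ → ℕ → Prop) : Prop :=
  (∀ n t, t < n → Q n t → P n t) ∧ ∃ n t, t < n ∧ P n t ∧ ¬ Q n t

end CAMP

namespace CAMP

variable {n : ℕ} {Inv Res : Type}

/-! ### Gossip algorithms -/

/-! Money transfer needs no quorum, because only the owner of an account withdraws from it. Each
process gossips a log of its own operations and of the transfers it has heard of, and decides an
operation at once on its own log. Different logs may order concurrent transfers differently, but
every log is causally closed (`MT.Good`): an entry stands after all transfers that its issuer knew.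
At a transfer in any log, its issuer has therefore received at least what it counted when it checked
its funds, and has spent no more, since its later transfers depend on this one (`MT.le_balance`). So
the log of a process, in the limit, is itself an MT-compliant serialization of its view
(`MT.hasMTSerialization`). A result is returned only after the log has been sent to everybody, so
completed transfers reach all correct processes. A faulty process may know transfers that are lost
with it; its log is cut after its last operation that takes effect, and what remains belongs to the
common history (`MT.inHist_of_seen`).

A register cannot do without a majority (`two_mul_lt_of_solvable`). If `n ≤ 2 * t`, the processes
split into two groups that must each be able to work while the other is silent. A write in one group
followed by a read in the other, with all messages between them delayed, is a prefix of a crash-free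
execution in which the read misses the write. With a majority of correct processes, the algorithm of
Attiya, Bar-Noy and Dolev works: an operation first queries a majority for the largest tag, then
propagates a tag and value to a majority. Since majorities intersect, tags respect real time
(`Reg.tag_le_of_returns`), and sorting by tag linearizes the run (`Reg.atomicSpec`). With one
writer, writes are sequential, so atomic implies regular, which implies safe. The separation occurs
at two processes and one crash. -/

/-- The local behaviour of a process that sends its whole state again and again to all
processes. -/
structure Gossip (n : ℕ) (Inv Res : Type) where
  St : Type
  start : Fin n → St
  inv : Fin n → St → Inv → St
  rcv : Fin n → St → Fin n → St → St
  out : Fin n → St → St × Option Res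

namespace Gossip

/-- In each computation step, the present state is sent to the next process, in cyclic order. -/
def alg (D : Gossip n Inv Res) : Algorithm n Inv Res where
  State := D.St × ℕ
  Msg := D.St
  start p := (D.start p, 0)
  invoke p s o := (D.inv p s.1 o, s.2)
  receive p s q m := (D.rcv p s.1 q m, s.2)
  compute p s :=
    (((D.out p s.1).1, s.2 + 1), some (⟨s.2 % n, Nat.mod_lt _ p.pos⟩, s.1), (D.out p s.1).2)

variable {D : Gossip n Inv Res}

def st (R : Run D.alg) (k : ℕ) (p : Fin n) : D.St := (R.state k p).1

def cnt (R : Run D.alg) (k : ℕ) (p : Fin n) : ℕ := (R.state k p).2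

section Steps

variable {R : Run D.alg} {t : ℕ} {allowed : Fin n → Inv → Prop} {k : ℕ}

theorem state_of_ne (h : R.IsStep k) {p : Fin n} (hp : p ≠ R.proc k) :
    R.state (k + 1) p = R.state k p := by
  unfold Run.IsStep at h
  split at h
  · rw [h, Function.update_of_ne hp]
  · obtain ⟨-, m, -, h⟩ := h
    rw [h, Function.update_of_ne hp]
  · rw [h, Function.update_of_ne hp]

theorem st_of_ne (h : R.IsStep k) {p : Fin n} (hp : p ≠ R.proc k) :
    st R (k + 1) p = st R k p := by
  rw [st, state_of_ne h hp, st]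

theorem cnt_of_ne (h : R.IsStep k) {p : Fin n} (hp : p ≠ R.proc k) :
    cnt R (k + 1) p = cnt R k p := by
  rw [cnt, state_of_ne h hp, cnt]

theorem state_invoke (h : R.IsStep k) {o : Inv} (ha : R.act k = .invoke o) :
    st R (k + 1) (R.proc k) = D.inv (R.proc k) (st R k (R.proc k)) o ∧
      cnt R (k + 1) (R.proc k) = cnt R k (R.proc k) := by
  unfold Run.IsStep at h
  simp only [ha] at h
  simp [st, cnt, h, alg]

theorem state_compute (h : R.IsStep k) (ha : R.act k = .compute) :
    st R (k + 1) (R.proc k) = (D.out (R.proc k) (st R k (R.proc k))).1 ∧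
      cnt R (k + 1) (R.proc k) = cnt R k (R.proc k) + 1 := by
  unfold Run.IsStep at h
  simp only [ha] at h
  simp [st, cnt, h, alg]

theorem sent_eq_some {q : Fin n} {m : D.St} :
    R.sent k = some (q, m) ↔ R.act k = .compute ∧ m = st R k (R.proc k) ∧
      (q : ℕ) = cnt R k (R.proc k) % n := by
  unfold Run.sent
  cases ha : R.act k <;> simp [alg, st, cnt, Fin.ext_iff, eq_comm, and_comm]

theorem state_receive (h : R.IsStep k) {s : ℕ} (ha : R.act k = .receive s) :
    s < k ∧ st R (k + 1) (R.proc k) =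
        D.rcv (R.proc k) (st R k (R.proc k)) (R.proc s) (st R s (R.proc s)) ∧
      cnt R (k + 1) (R.proc k) = cnt R k (R.proc k) := by
  unfold Run.IsStep at h
  simp only [ha] at h
  obtain ⟨hs, m, hm, h⟩ := h
  replace hm := sent_eq_some.1 hm
  refine ⟨hs, ?_⟩
  simp [st, cnt, h, alg, hm.2.1]

theorem trace_inv {o : Inv} : R.trace.inv k = some o ↔ R.act k = .invoke o := by
  unfold Run.trace
  cases ha : R.act k <;> simp [ha]

theorem trace_out {r : Res} : R.trace.out k = some r ↔
    R.act k = .compute ∧ (D.out (R.proc k) (st R k (R.proc k))).2 = some r := by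
  unfold Run.trace
  cases ha : R.act k <;> simp [ha, alg, st]

/-- A property of local states that is preserved by time and by all steps is invariant. -/
theorem invariant (h : R.IsExecution t allowed) (P : ℕ → Fin n → D.St → Prop)
    (mono : ∀ k p s, P k p s → P (k + 1) p s) (start : ∀ p, P 0 p (D.start p))
    (inv : ∀ k o, R.act k = .invoke o → P k (R.proc k) (st R k (R.proc k)) →
      P (k + 1) (R.proc k) (D.inv (R.proc k) (st R k (R.proc k)) o))
    (rcv : ∀ k s, R.act k = .receive s → s < k → P k (R.proc k) (st R k (R.proc k)) →
      P k (R.proc s) (st R s (R.proc s)) →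
      P (k + 1) (R.proc k) (D.rcv (R.proc k) (st R k (R.proc k)) (R.proc s) (st R s (R.proc s))))
    (out : ∀ k, R.act k = .compute → P k (R.proc k) (st R k (R.proc k)) →
      P (k + 1) (R.proc k) (D.out (R.proc k) (st R k (R.proc k))).1) (k : ℕ) (p : Fin n) :
    P k p (st R k p) := by
  have mono' : ∀ j k p s, j ≤ k → P j p s → P k p s := by
    intro j k p s hjk hj
    induction hjk with
    | refl => exact hj
    | step _ ih => exact mono _ _ _ ih
  induction k using Nat.strong_induction_on generalizing p with
  | _ k ih =>
    cases k with
    | zero =>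
      have : st R 0 p = D.start p := by simp [st, h.start, alg]
      rw [this]
      exact start p
    | succ k =>
      by_cases hp : p = R.proc k
      · subst hp
        have hk := ih k k.lt_succ_self (R.proc k)
        cases ha : R.act k with
        | invoke o =>
          rw [(state_invoke (h.step k) ha).1]
          exact inv k o ha hk
        | receive s =>
          obtain ⟨hs, hst, -⟩ := state_receive (h.step k) ha
          rw [hst]
          -- The message carries the sender's state at the earlier event `s`; this is why the
          -- induction is strong and `P` must persist in time.
          exact rcv k s ha hs hk (mono' s k _ _ hs.le (ih s (hs.trans k.lt_succ_self) _))
        | compute =>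
          rw [(state_compute (h.step k) ha).1]
          exact out k ha hk
      · rw [st_of_ne (h.step k) hp]
        exact mono _ _ _ (ih k k.lt_succ_self p)

/-- A preorder that is respected by all steps is respected by time. -/
theorem st_mono (h : R.IsExecution t allowed) (r : D.St → D.St → Prop) (refl : ∀ s, r s s)
    (trans : ∀ a b c, r a b → r b c → r a c) (inv : ∀ p s o, r s (D.inv p s o))
    (rcv : ∀ p s q m, r s (D.rcv p s q m)) (out : ∀ p s, r s (D.out p s).1) (p : Fin n)
    {j k : ℕ} (hjk : j ≤ k) : r (st R j p) (st R k p) := by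
  induction hjk with
  | refl => exact refl _
  | @step k _ ih =>
    refine trans _ _ _ ih ?_
    by_cases hp : p = R.proc k
    · subst hp
      cases ha : R.act k with
      | invoke o =>
        rw [(state_invoke (h.step k) ha).1]
        exact inv _ _ _
      | receive s =>
        rw [(state_receive (h.step k) ha).2.1]
        exact rcv _ _ _ _
      | compute =>
        rw [(state_compute (h.step k) ha).1]
        exact out _ _
    · rw [st_of_ne (h.step k) hp]
      exact refl _

theorem cnt_succ (h : R.IsExecution t allowed) (k : ℕ) (p : Fin n) :
    cnt R (k + 1) p = cnt R k p ∨
      R.proc k = p ∧ R.act k = .compute ∧ cnt R (k + 1) p = cnt R k p + 1 := by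
  by_cases hp : p = R.proc k
  · subst hp
    cases ha : R.act k with
    | invoke o => exact .inl (state_invoke (h.step k) ha).2
    | receive s => exact .inl (state_receive (h.step k) ha).2.2
    | compute => exact .inr ⟨rfl, rfl, (state_compute (h.step k) ha).2⟩
  · exact .inl (cnt_of_ne (h.step k) hp)

/-- A discrete intermediate value property: the counter moves only in computation steps, and by one.
-/
theorem exists_compute_of_cnt (h : R.IsExecution t allowed) (p : Fin n) {j k c : ℕ} (hjk : j ≤ k)
    (hj : cnt R j p ≤ c) (hk : c < cnt R k p) :
    ∃ m, j ≤ m ∧ m < k ∧ R.proc m = p ∧ R.act m = .compute ∧ cnt R m p = c := by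
  induction hjk with
  | refl => omega
  | @step k hjk ih =>
    by_cases hc : c < cnt R k p
    · obtain ⟨m, h1, h2, h3⟩ := ih hc
      exact ⟨m, h1, h2.trans k.lt_succ_self, h3⟩
    · rcases cnt_succ h k p with h1 | ⟨h1, h2, h3⟩
      · simp only [Nat.succ_eq_add_one] at hk
        omega
      · simp only [Nat.succ_eq_add_one] at hk
        exact ⟨k, hjk, k.lt_succ_self, h1, h2, by omega⟩

theorem cnt_mono (h : R.IsExecution t allowed) (p : Fin n) : Monotone fun k => cnt R k p :=
  monotone_nat_of_le_succ fun k => by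
    rcases cnt_succ h k p with h1 | ⟨-, -, h1⟩ <;> omega

theorem exists_cnt_gt (h : R.IsExecution t allowed) {p : Fin n} (hp : R.trace.Correct p) (c : ℕ) :
    ∃ k, c < cnt R k p := by
  induction c with
  | zero =>
    obtain ⟨k, -, h1, h2⟩ := h.progress p hp 0
    subst h1
    exact ⟨k + 1, by rw [(state_compute (h.step k) h2).2]; omega⟩
  | succ c ih =>
    obtain ⟨j, hj⟩ := ih
    obtain ⟨k, hk, h1, h2⟩ := h.progress p hp j
    subst h1
    have := cnt_mono h (R.proc k) hk
    exact ⟨k + 1, by rw [(state_compute (h.step k) h2).2]; simp only at this; omega⟩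

/-- A state from which `n` consecutive messages are sent is received, possibly with additions, by
every correct process. -/
theorem exists_receive_of_cnt (h : R.IsExecution t allowed) {p q : Fin n} {j k : ℕ} (hjk : j ≤ k)
    (hc : cnt R j p + n ≤ cnt R k p) (hq : R.trace.Correct q) :
    ∃ m m', j ≤ m ∧ m < k ∧ R.proc m = p ∧ R.proc m' = q ∧ R.act m' = .receive m := by
  -- Destinations are counter values modulo `n`, so a window of `n` consecutive values contains one
  -- that addresses `q`.
  obtain ⟨c, h1, h2, h3⟩ : ∃ c, cnt R j p ≤ c ∧ c < cnt R j p + n ∧ c % n = q := by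
    have hn := q.pos
    have hq' := q.isLt
    have h4 := Nat.mod_lt (cnt R j p) hn
    have h5 := Nat.div_add_mod (cnt R j p) n
    by_cases h6 : cnt R j p % n ≤ q
    · refine ⟨n * (cnt R j p / n) + q, by omega, by omega, ?_⟩
      rw [Nat.mul_add_mod, Nat.mod_eq_of_lt hq']
    · refine ⟨n * (cnt R j p / n + 1) + q, by rw [mul_add]; omega, by rw [mul_add]; omega, ?_⟩
      rw [Nat.mul_add_mod, Nat.mod_eq_of_lt hq']
  obtain ⟨m, hm1, hm2, hm3, hm4, hm5⟩ := exists_compute_of_cnt h p hjk h1 (h2.trans_le hc)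
  subst hm3
  have hs : R.sent m = some (q, st R m (R.proc m)) :=
    sent_eq_some.2 ⟨hm4, rfl, by rw [hm5, h3]⟩
  obtain ⟨m', hm'⟩ := h.noLoss _ _ _ hs hq
  refine ⟨m, m', hm1, hm2, rfl, ?_, hm'⟩
  have := h.step m'
  unfold Run.IsStep at this
  simp only [hm'] at this
  obtain ⟨-, x, hx, -⟩ := this
  rw [hs] at hx
  exact (Prod.mk.inj (Option.some.inj hx)).1.symm

theorem exists_receive (h : R.IsExecution t allowed) {p q : Fin n} (hp : R.trace.Correct p)
    (hq : R.trace.Correct q) (j : ℕ) :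
    ∃ m m', j ≤ m ∧ R.proc m = p ∧ R.proc m' = q ∧ R.act m' = .receive m := by
  obtain ⟨k, hk⟩ := exists_cnt_gt h hp (cnt R j p + n)
  have hjk : j ≤ k := by
    by_contra hjk
    have := cnt_mono h p (not_le.1 hjk).le
    simp only at this
    omega
  obtain ⟨m, m', h1, -, h2, h3, h4⟩ := exists_receive_of_cnt h hjk hk.le hq
  exact ⟨m, m', h1, h2, h3, h4⟩

end Steps

end Gossip

theorem Run.IsExecution.exists_correct {A : Algorithm n Inv Res} {R : Run A} {t : ℕ}
    {allowed : Fin n → Inv → Prop} (h : R.IsExecution t allowed) (ht : t < n) :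
    ∃ p, R.trace.Correct p := by
  by_contra hc
  have : {p | R.trace.Faulty p} = Set.univ := by
    ext p
    have := not_exists.1 hc p
    simpa [Trace.Correct] using this
  have h1 := h.crashes
  rw [this, Set.ncard_univ, Nat.card_eq_fintype_card, Fintype.card_fin] at h1
  omega

/-- A functional relation is a sequence with empty slots. -/
theorem exists_sequence {β : Type*} (P : ℕ → β → Prop) (hP : ∀ x k k', P x k → P x k' → k = k') :
    ∃ S : ℕ → Option β, ∀ x k, S x = some k ↔ P x k := by
  classical
  refine ⟨fun x => if h : ∃ k, P x k then some h.choose else none, fun x k => ?_⟩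
  dsimp only
  split_ifs with h
  · rw [Option.some.injEq]
    exact ⟨fun e => e ▸ h.choose_spec, fun hk => hP _ _ _ h.choose_spec hk⟩
  · simp only [false_iff]
    exact fun hk => h ⟨k, hk⟩

end CAMP

namespace CAMP

/-! ### Money transfer -/

/-- An operation that is recorded in the logs; `seq` is the length of the log of its issuer at its
invocation. -/
structure MTEntry (n : ℕ) where
  src : Fin n
  seq : ℕ
  op : MTOp n
  res : MTRes

namespace MTEntry

variable {n : ℕ}

def toOp (e : MTEntry n) : Operation n (MTOp n) MTRes := ⟨e.src, e.op, e.res⟩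

/-- The value of an account according to a log. -/
noncomputable def balance (init : Fin n → ℝ) (l : List (MTEntry n)) (j : Fin n) : ℝ :=
  init j + (l.map fun e => e.toOp.plus j).sum - (l.map fun e => e.toOp.minus j).sum

open Classical in
/-- The entry for an operation issued by a process `p` with log `l`. -/
noncomputable def new (init : Fin n → ℝ) (p : Fin n) (l : List (MTEntry n)) (o : MTOp n) :
    MTEntry n :=
  ⟨p, l.length, o, match o with
    | .balance j => .value (balance init l j)
    | .transfer _ v => if v ≤ balance init l p then .commit else .abort⟩

open Classical in
/-- Append the unknown transfers of the log `m` to the log `l`. -/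
noncomputable def merge (l m : List (MTEntry n)) : List (MTEntry n) :=
  l ++ m.filter fun e => decide (e.toOp.isTransfer = true ∧ e ∉ l)

theorem mem_merge {l m : List (MTEntry n)} {e : MTEntry n} :
    e ∈ merge l m ↔ e ∈ l ∨ e ∈ m ∧ e.toOp.isTransfer = true := by
  simp only [merge, List.mem_append, List.mem_filter, decide_eq_true_eq]
  tauto

end MTEntry

structure MTState (n : ℕ) where
  log : List (MTEntry n)
  pend : Option MTRes
  todo : ℕ

/-- Each process keeps a log of its own operations and of all transfers it knows of. An operation
takes effect on the log of its issuer at its invocation; its result is returned as soon as the log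
has been sent to all processes. -/
noncomputable def mtGossip {n : ℕ} (init : Fin n → ℝ) : Gossip n (MTOp n) MTRes where
  St := MTState n
  start _ := ⟨[], none, 0⟩
  inv p s o := ⟨s.log ++ [MTEntry.new init p s.log o], some (MTEntry.new init p s.log o).res, n⟩
  rcv _ s _ m := { s with log := MTEntry.merge s.log m.log }
  out _ s :=
    match s.pend with
    | none => (s, none)
    | some r => if s.todo ≤ 1 then ({ s with pend := none }, some r)
      else ({ s with todo := s.todo - 1 }, none)

namespace MT

open Gossip MTEntry

variable {n t : ℕ} {init : Fin n → ℝ}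

theorem out_log (p : Fin n) (s : MTState n) :
    (((mtGossip init).out p s).1 : MTState n).log = s.log := by
  simp only [mtGossip]
  split
  · rfl
  · split_ifs <;> rfl

/-- The log of process `p` before event `k`. -/
noncomputable def log (R : Run (mtGossip init).alg) (k : ℕ) (p : Fin n) : List (MTEntry n) :=
  MTState.log (st R k p)

/-- The entry made in event `k`. -/
noncomputable def entryAt (R : Run (mtGossip init).alg) (k : ℕ) : Option (MTEntry n) :=
  match R.act k with
  | .invoke o => some (MTEntry.new init (R.proc k) (log R k (R.proc k)) o)
  | _ => none

/-- The transfer `f` was known to the issuer of `e` when it issued `e`. -/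
def Dep (R : Run (mtGossip init).alg) (e f : MTEntry n) : Prop :=
  f.toOp.isTransfer = true ∧ ∃ k, entryAt R k = some e ∧ f ∈ log R k e.src

/-- A log without repetitions in which entries stand after the transfers they depend on. -/
inductive Good (R : Run (mtGossip init).alg) : List (MTEntry n) → Prop
  | nil : Good R []
  | snoc {l e} (hl : Good R l) (he : e ∉ l) (hd : ∀ f, Dep R e f → f ∈ l) : Good R (l ++ [e])

variable {R : Run (mtGossip init).alg}

theorem Good.spec {l : List (MTEntry n)} (hl : Good R l) {x : ℕ} {e : MTEntry n}
    (hx : l[x]? = some e) : e ∉ l.take x ∧ ∀ f, Dep R e f → f ∈ l.take x := by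
  induction hl with
  | nil => simp at hx
  | @snoc l e' hl he hd ih =>
    rcases lt_trichotomy x l.length with h | h | h
    · rw [List.getElem?_append_left h] at hx
      rw [List.take_append_of_le_length h.le]
      exact ih hx
    · subst h
      simp only [List.getElem?_concat_length, Option.some.injEq] at hx
      subst hx
      simpa using ⟨he, hd⟩
    · rw [List.getElem?_eq_none (by simpa using h)] at hx
      cases hx

theorem Good.pos_unique {l : List (MTEntry n)} (hl : Good R l) {x y : ℕ} {e : MTEntry n}
    (hx : l[x]? = some e) (hy : l[y]? = some e) : x = y := by
  have key : ∀ {x y : ℕ}, l[x]? = some e → l[y]? = some e → ¬ x < y := by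
    intro x y hx hy hxy
    refine (hl.spec hy).1 (List.mem_iff_getElem?.2 ⟨x, ?_⟩)
    rw [List.getElem?_take_of_lt hxy, hx]
  exact le_antisymm (not_lt.1 (key hy hx)) (not_lt.1 (key hx hy))

theorem Good.nodup {l : List (MTEntry n)} (hl : Good R l) : l.Nodup := by
  induction hl with
  | nil => exact List.nodup_nil
  | snoc hl he _ ih =>
    rw [List.nodup_append]
    exact ⟨ih, List.nodup_singleton _, by rintro a ha b hb rfl; simp at hb; exact he (hb ▸ ha)⟩

/-- Only transfers are copied, and dependencies are transfers by definition. So a dependency of a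
copied entry, which stands before it in `m`, is either in `l` already or copied before it. -/
theorem Good.merge {l m : List (MTEntry n)} (hl : Good R l) (hm : Good R m) :
    Good R (MTEntry.merge l m) := by
  induction hm with
  | nil => simpa [MTEntry.merge] using hl
  | @snoc m e hm he hd ih =>
    by_cases h : e.toOp.isTransfer = true ∧ e ∉ l
    · have : MTEntry.merge l (m ++ [e]) = MTEntry.merge l m ++ [e] := by
        simp [MTEntry.merge, List.filter_append, h]
      rw [this]
      refine .snoc ih ?_ fun f hf => mem_merge.2 (.inr ⟨hd f hf, hf.1⟩)
      rw [mem_merge]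
      tauto
    · have : MTEntry.merge l (m ++ [e]) = MTEntry.merge l m := by
        simp only [MTEntry.merge, List.filter_append, List.filter_singleton, h]
        simp
      rw [this]
      exact ih

theorem entryAt_eq_some {k : ℕ} {e : MTEntry n} : entryAt R k = some e ↔
    ∃ o, R.act k = .invoke o ∧ MTEntry.new init (R.proc k) (log R k (R.proc k)) o = e := by
  unfold entryAt
  cases R.act k <;> simp

theorem entryAt_src {k : ℕ} {e : MTEntry n} (h : entryAt R k = some e) : e.src = R.proc k := by
  obtain ⟨o, -, rfl⟩ := entryAt_eq_some.1 h
  rfl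

theorem entryAt_seq {k : ℕ} {e : MTEntry n} (h : entryAt R k = some e) :
    e.seq = (log R k (R.proc k)).length := by
  obtain ⟨o, -, rfl⟩ := entryAt_eq_some.1 h
  rfl

section

variable (h : R.IsExecution t mtAllowed)
include h

theorem log_prefix (p : Fin n) {j k : ℕ} (hjk : j ≤ k) : log R j p <+: log R k p := by
  refine st_mono h (fun a b : MTState n => a.log <+: b.log) (fun _ => List.prefix_rfl)
    (fun _ _ _ => List.IsPrefix.trans) ?_ ?_ ?_ p hjk
  · intro p s o
    exact List.prefix_append _ _
  · intro p s q m
    exact List.prefix_append _ _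
  · intro p s
    exact ⟨[], (List.append_nil _).trans (out_log p s).symm⟩

theorem log_of_entryAt {k : ℕ} {e : MTEntry n} (he : entryAt R k = some e) :
    log R (k + 1) (R.proc k) = log R k (R.proc k) ++ [e] := by
  obtain ⟨o, ho, rfl⟩ := entryAt_eq_some.1 he
  rw [log, (state_invoke (h.step k) ho).1]
  rfl

/-- The field `seq` makes entries unique: it is the length of the issuer's log, which grows at each
invocation. -/
theorem entryAt_inj {j k : ℕ} {e : MTEntry n} (hj : entryAt R j = some e)
    (hk : entryAt R k = some e) : j = k := by
  have key : ∀ {j k : ℕ}, entryAt R j = some e → entryAt R k = some e → ¬ j < k := by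
    intro j k hj hk hjk
    have h1 := (log_prefix h (R.proc j) (Nat.succ_le_of_lt hjk)).length_le
    rw [Nat.succ_eq_add_one, log_of_entryAt h hj] at h1
    have h2 := entryAt_seq hj
    have h3 := entryAt_seq hk
    rw [← entryAt_src hk, entryAt_src hj] at h3
    rw [List.length_append, List.length_singleton] at h1
    omega
  exact le_antisymm (not_lt.1 (key hk hj)) (not_lt.1 (key hj hk))

theorem exists_entryAt {k : ℕ} {p : Fin n} {e : MTEntry n} (he : e ∈ log R k p) :
    (∃ j < k, entryAt R j = some e) ∧ (e.src = p ∨ e.toOp.isTransfer = true) := by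
  refine invariant h (fun k p s => ∀ e ∈ MTState.log s,
    (∃ j < k, entryAt R j = some e) ∧ (e.src = p ∨ e.toOp.isTransfer = true)) ?_ ?_ ?_ ?_ ?_ k p e he
  · intro k p s hs e he
    obtain ⟨⟨j, hj, hje⟩, h2⟩ := hs e he
    exact ⟨⟨j, hj.trans k.lt_succ_self, hje⟩, h2⟩
  · intro p e he
    cases he
  · intro k o ho hk e he
    rcases List.mem_append.1 he with he | he
    · obtain ⟨⟨j, hj, hje⟩, h2⟩ := hk e he
      exact ⟨⟨j, hj.trans k.lt_succ_self, hje⟩, h2⟩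
    · rw [List.mem_singleton] at he
      exact ⟨⟨k, k.lt_succ_self, entryAt_eq_some.2 ⟨o, ho, he.symm⟩⟩, .inl (by rw [he]; rfl)⟩
  · intro k s _ hs hk hs' e he
    rcases mem_merge.1 he with he | he
    · obtain ⟨⟨j, hj, hje⟩, h2⟩ := hk e he
      exact ⟨⟨j, hj.trans k.lt_succ_self, hje⟩, h2⟩
    · obtain ⟨⟨j, hj, hje⟩, -⟩ := hs' e he.1
      exact ⟨⟨j, hj.trans k.lt_succ_self, hje⟩, .inr he.2⟩
  · intro k _ hk e he
    replace he := (congrArg (e ∈ ·) (out_log (init := init) _ _)).mp he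
    obtain ⟨⟨j, hj, hje⟩, h2⟩ := hk e he
    exact ⟨⟨j, hj.trans k.lt_succ_self, hje⟩, h2⟩

/-- A new entry is fresh because everything in a log was made in an earlier event, and its
dependencies lie in the log it is appended to. Receptions are covered by `Good.merge`. -/
theorem good_log (k : ℕ) (p : Fin n) : Good R (log R k p) := by
  refine invariant h (fun k p s => Good R (MTState.log s)) ?_ ?_ ?_ ?_ ?_ k p
  · exact fun _ _ _ h => h
  · exact fun _ => .nil
  · intro k o ho hk
    have he : entryAt R k = some (MTEntry.new init (R.proc k) (log R k (R.proc k)) o) :=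
      entryAt_eq_some.2 ⟨o, ho, rfl⟩
    refine Good.snoc hk (fun hm => ?_) ?_
    · obtain ⟨⟨j, hj, hje⟩, -⟩ := exists_entryAt h (k := k) (p := R.proc k) hm
      exact hj.ne (entryAt_inj h hje he)
    · rintro f ⟨-, j, hj, hf⟩
      rw [entryAt_inj h hj he] at hf
      exact hf
  · intro k s _ _ hk hs
    exact hk.merge hs
  · intro k _ hk
    exact (congrArg (Good R) (out_log _ _)).mpr hk

end

end MT

end CAMP

/-! ### Available money, pending operations and the spreading of transfers. -/

namespace CAMP

namespace MT

open Gossip MTEntry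

variable {n t : ℕ} {init : Fin n → ℝ} {R : Run (mtGossip init).alg}

theorem isTransfer_iff {a : Operation n (MTOp n) MTRes} :
    a.isTransfer = true ↔ ∃ j v, a.op = .transfer j v ∧ a.res = .commit := by
  obtain ⟨p, op, res⟩ := a
  unfold Operation.isTransfer
  cases op <;> cases res <;> simp

theorem plus_nonneg {a : Operation n (MTOp n) MTRes} (ha : ∀ d v, a.op = .transfer d v → 0 ≤ v)
    {j : Fin n} : 0 ≤ a.plus j := by
  unfold Operation.plus
  split
  · split_ifs
    · exact ha _ _ (by assumption)
    · exact le_rfl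
  · exact le_rfl

theorem minus_nonneg {a : Operation n (MTOp n) MTRes} (ha : ∀ d v, a.op = .transfer d v → 0 ≤ v)
    {j : Fin n} : 0 ≤ a.minus j := by
  unfold Operation.minus
  split
  · split_ifs
    · exact ha _ _ (by assumption)
    · exact le_rfl
  · exact le_rfl

theorem plus_ne_zero {a : Operation n (MTOp n) MTRes} {j : Fin n} (h : a.plus j ≠ 0) :
    a.isTransfer = true := by
  unfold Operation.plus at h
  split at h
  · exact isTransfer_iff.2 ⟨_, _, by assumption, by assumption⟩
  · exact absurd rfl h

theorem minus_ne_zero {a : Operation n (MTOp n) MTRes} {j : Fin n} (h : a.minus j ≠ 0) :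
    a.isTransfer = true ∧ a.proc = j := by
  unfold Operation.minus at h
  split at h
  · split_ifs at h with hj
    · exact ⟨isTransfer_iff.2 ⟨_, _, by assumption, by assumption⟩, hj⟩
    · exact absurd rfl h
  · exact absurd rfl h

section

variable (h : R.IsExecution t mtAllowed)
include h

theorem log_getElem? {p : Fin n} {j k x : ℕ} {e : MTEntry n} (hjk : j ≤ k)
    (hx : (log R j p)[x]? = some e) : (log R k p)[x]? = some e := by
  obtain ⟨s, hs⟩ := log_prefix h p hjk
  rw [← hs, List.getElem?_append_left (List.getElem?_eq_some_iff.1 hx).1, hx]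

theorem log_take {p : Fin n} {j k x : ℕ} (hjk : j ≤ k) (hx : x ≤ (log R j p).length) :
    (log R k p).take x = (log R j p).take x := by
  obtain ⟨s, hs⟩ := log_prefix h p hjk
  rw [← hs, List.take_append_of_le_length hx]

theorem mem_log_mono {p : Fin n} {j k : ℕ} {e : MTEntry n} (hjk : j ≤ k) (he : e ∈ log R j p) :
    e ∈ log R k p :=
  (log_prefix h p hjk).subset he

theorem pos_unique {p : Fin n} {j k x y : ℕ} {e : MTEntry n} (hx : (log R j p)[x]? = some e)
    (hy : (log R k p)[y]? = some e) : x = y :=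
  (good_log h (max j k) p).pos_unique (log_getElem? h (le_max_left j k) hx)
    (log_getElem? h (le_max_right j k) hy)

theorem mem_log_of_entryAt {j k : ℕ} {e : MTEntry n} (he : entryAt R j = some e) (hjk : j < k) :
    e ∈ log R k (R.proc j) :=
  mem_log_mono h (Nat.succ_le_of_lt hjk) (by
    rw [Nat.succ_eq_add_one, log_of_entryAt h he]
    simp)

/-- An entry stands in the log of its issuer after exactly what its issuer knew. -/
theorem take_of_own {i : Fin n} {j k x : ℕ} {e : MTEntry n} (hx : (log R k i)[x]? = some e)
    (he : entryAt R j = some e) (hi : R.proc j = i) : (log R k i).take x = log R j i := by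
  subst hi
  have h1 : (log R (j + 1) (R.proc j))[(log R j (R.proc j)).length]? = some e := by
    rw [log_of_entryAt h he]
    simp
  have h2 := pos_unique h hx h1
  obtain ⟨⟨j', hj', hje⟩, -⟩ := exists_entryAt h (List.mem_of_getElem? hx)
  rw [entryAt_inj h hje he] at hj'
  rw [h2, log_take h hj'.le le_rfl, List.take_length]

/-- Money that an entry transfers is available in each log that contains the entry. -/
theorem le_balance {i : Fin n} {k x : ℕ} {e : MTEntry n} (hx : (log R k i)[x]? = some e)
    {d : Fin n} {v : ℝ} (hop : e.op = .transfer d v) (hres : e.res = .commit) :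
    v ≤ balance init ((log R k i).take x) e.src := by
  classical
  have htr : ∀ j {e : MTEntry n} {d v}, entryAt R j = some e → e.op = .transfer d v → 0 ≤ v := by
    intro j e d v he hop
    obtain ⟨o, ho, rfl⟩ := entryAt_eq_some.1 he
    have := h.properUse.1 j o (trace_inv.2 ho)
    obtain rfl : o = .transfer d v := hop
    exact this.2
  -- For lists without repetitions, a sum is monotone as soon as the entries with non-zero
  -- contribution are included and the extra ones contribute non-negatively. This ignores the
  -- different orders of the two logs.
  have mono : ∀ (f : MTEntry n → ℝ) (l m : List (MTEntry n)), l.Nodup → m.Nodup →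
      (∀ a ∈ m, 0 ≤ f a) → (∀ a ∈ l, f a ≠ 0 → a ∈ m) → (l.map f).sum ≤ (m.map f).sum := by
    intro f l m hl hm h0 hlm
    rw [← List.sum_toFinset f hl, ← List.sum_toFinset f hm, ← Finset.sum_filter_ne_zero]
    refine Finset.sum_le_sum_of_subset_of_nonneg ?_ ?_
    · intro a ha
      simp only [Finset.mem_filter, List.mem_toFinset] at ha ⊢
      exact hlm a ha.1 ha.2
    · intro a ha _
      exact h0 a (List.mem_toFinset.1 ha)
  obtain ⟨⟨j, -, he⟩, -⟩ := exists_entryAt h (List.mem_of_getElem? hx)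
  have hsrc := entryAt_src he
  have hg := (good_log h k i).spec hx
  have hnd := (good_log h k i).nodup.sublist (List.take_sublist x (log R k i))
  have htake : ∀ {a}, a ∈ (log R k i).take x → ∃ y, y < x ∧ (log R k i)[y]? = some a := by
    intro a ha
    obtain ⟨y, hy⟩ := List.mem_iff_getElem?.1 ha
    rw [List.getElem?_take] at hy
    split_ifs at hy with hyx
    exact ⟨y, hyx, hy⟩
  have hv : v ≤ balance init (log R j e.src) e.src := by
    obtain ⟨o, ho, rfl⟩ := entryAt_eq_some.1 he
    obtain rfl : o = .transfer d v := hop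
    simp only [MTEntry.new] at hres ⊢
    by_contra hc
    rw [if_neg hc] at hres
    cases hres
  refine hv.trans ?_
  -- Incoming money: all transfers that the issuer knew stand before `e`.
  have h1 := mono (fun a => a.toOp.plus e.src) (log R j e.src) ((log R k i).take x)
    (good_log h _ _).nodup hnd (fun a ha => ?_) (fun a ha h0 => ?_)
  -- Outgoing money: each transfer of the issuer before `e` in this log was already in the issuer's
  -- own log.
  · have h2 := mono (fun a => a.toOp.minus e.src) ((log R k i).take x) (log R j e.src)
      hnd (good_log h _ _).nodup (fun a ha => ?_) (fun a ha h0 => ?_)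
    · unfold balance
      linarith
    · obtain ⟨⟨j', -, hj'⟩, -⟩ := exists_entryAt h ha
      exact minus_nonneg fun d v hop => htr j' (e := a) hj' hop
    · obtain ⟨-, hs⟩ := minus_ne_zero h0
      replace hs : a.src = e.src := hs
      obtain ⟨y, hyx, hy⟩ := htake ha
      obtain ⟨⟨j', -, hj'⟩, -⟩ := exists_entryAt h (List.mem_of_getElem? hy)
      have hpp : R.proc j' = R.proc j := by rw [← entryAt_src hj', hs, hsrc]
      rcases lt_trichotomy j' j with hlt | heq | hgt
      · rw [hsrc, ← hpp]
        exact mem_log_of_entryAt h hj' hlt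
      · subst heq
        rw [hj'] at he
        cases he
        exact absurd ha hg.1
      -- A transfer that the issuer made after `e` depends on `e`, so `e` would stand before it and
      -- hence occur twice.
      · refine absurd ?_ hg.1
        have hd : Dep R a e := by
          refine ⟨isTransfer_iff.2 ⟨d, v, hop, hres⟩, j', hj', ?_⟩
          rw [entryAt_src hj', hpp]
          exact mem_log_of_entryAt h he hgt
        have h3 := ((good_log h k i).spec hy).2 e hd
        exact (List.take_subset_take_left _ hyx.le) h3
  · obtain ⟨y, hyx, hy⟩ := htake ha
    obtain ⟨⟨j', -, hj'⟩, -⟩ := exists_entryAt h (List.mem_of_getElem? hy)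
    exact plus_nonneg fun d v hop => htr j' (e := a) hj' hop
  · exact hg.2 a ⟨plus_ne_zero h0, j, he, ha⟩

theorem log_of_receive {k s : ℕ} (hk : R.act k = .receive s) :
    log R (k + 1) (R.proc k) = MTEntry.merge (log R k (R.proc k)) (log R s (R.proc s)) := by
  rw [log, (state_receive (h.step k) hk).2.1]
  rfl

/-- Until the output, each computation step sends one message and lowers `todo` by one, so the sum
of `cnt` and `todo` is conserved. -/
theorem pending {k j : ℕ} {e : MTEntry n} (he : entryAt R k = some e) (hkj : k < j)
    (hout : ∀ m, k < m → m < j → R.proc m = R.proc k → R.trace.out m = none) :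
    MTState.pend (st R j (R.proc k)) = some e.res ∧
      cnt R j (R.proc k) + MTState.todo (st R j (R.proc k)) = cnt R (k + 1) (R.proc k) + n ∧
      1 ≤ MTState.todo (st R j (R.proc k)) := by
  obtain ⟨o, ho, rfl⟩ := entryAt_eq_some.1 he
  induction hkj with
  | refl =>
    rw [Nat.succ_eq_add_one, (state_invoke (h.step k) ho).1]
    exact ⟨rfl, rfl, (R.proc k).pos⟩
  | @step j hkj ih =>
    simp only [Nat.succ_eq_add_one] at hkj hout ⊢
    obtain ⟨h1, h2, h3⟩ := ih fun m hm hmj => hout m hm (hmj.trans j.lt_succ_self)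
    by_cases hp : R.proc j = R.proc k
    · rw [← hp] at h1 h2 h3 ⊢
      cases ha : R.act j with
      -- A new invocation would require that the pending operation has returned, contrary to the
      -- absence of outputs.
      | invoke o' =>
        obtain ⟨l, r, hr, hl⟩ := h.properUse.2 k j hkj hp.symm (by rw [trace_inv.2 ho]; rfl)
          (by rw [trace_inv.2 ha]; rfl)
        have := hout l hr.2.1 (hl.trans j.lt_succ_self) hr.2.2.1
        rw [hr.2.2.2.1] at this
        cases this
      | receive s =>
        rw [(state_receive (h.step j) ha).2.1, (state_receive (h.step j) ha).2.2]
        exact ⟨h1, h2, h3⟩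
      | compute =>
        have ho := hout j hkj j.lt_succ_self hp
        have ho' : ∀ r, ((mtGossip init).out (R.proc j) (st R j (R.proc j))).2 ≠ some r := by
          intro r hr
          rw [trace_out.2 ⟨ha, hr⟩] at ho
          cases ho
        rw [(state_compute (h.step j) ha).1, (state_compute (h.step j) ha).2]
        generalize st R j (R.proc j) = s at *
        obtain ⟨lg, pd, td⟩ := s
        obtain rfl : pd = _ := h1
        simp only [mtGossip] at h2 h3 ho' ⊢
        split_ifs at ho' ⊢ with htd
        · exact absurd rfl (ho' _)
        · dsimp only
          refine ⟨rfl, ?_, ?_⟩ <;> omega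
    · rw [st_of_ne (h.step j) (Ne.symm hp), cnt_of_ne (h.step j) (Ne.symm hp)]
      exact ⟨h1, h2, h3⟩

omit h in
theorem entryAt_of_inv {k : ℕ} (hk : (R.trace.inv k).isSome) :
    ∃ e, entryAt R k = some e ∧ R.trace.inv k = some e.op := by
  obtain ⟨o, ho⟩ := Option.isSome_iff_exists.1 hk
  exact ⟨_, entryAt_eq_some.2 ⟨o, trace_inv.1 ho, rfl⟩, ho⟩

/-- The output occurs when `todo` is 1, and event `l` itself sends the last of the `n` messages;
hence the counter is taken at `l + 1`. -/
theorem returns_spec {k l : ℕ} {r : MTRes} (hr : R.trace.Returns k l r) :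
    ∃ e, entryAt R k = some e ∧ e.res = r ∧
      cnt R (k + 1) (R.proc k) + n ≤ cnt R (l + 1) (R.proc k) := by
  obtain ⟨e, he, -⟩ := entryAt_of_inv hr.1
  obtain ⟨-, hkl, hp, ho, hout⟩ := hr
  obtain ⟨h1, h2, h3⟩ := pending h he hkl hout
  replace hp : R.proc l = R.proc k := hp
  obtain ⟨ha, ho⟩ := trace_out.1 ho
  refine ⟨e, he, ?_⟩
  rw [← hp] at h1 h2 h3 ⊢
  rw [(state_compute (h.step l) ha).2]
  generalize st R l (R.proc l) = s at *
  obtain ⟨lg, pd, td⟩ := s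
  obtain rfl : pd = _ := h1
  simp only [mtGossip] at h2 h3 ho ⊢
  split_ifs at ho with htd
  exact ⟨Option.some.inj ho, by omega⟩

/-- The counter of a correct process grows without bound, whereas `pending` bounds it as long as
nothing is output. -/
theorem terminates : R.trace.Terminates := by
  intro k hk hc
  replace hc : R.trace.Correct (R.proc k) := hc
  obtain ⟨e, he, -⟩ := entryAt_of_inv hk
  classical
  obtain ⟨j, hj⟩ := exists_cnt_gt h hc (cnt R (k + 1) (R.proc k) + n)
  have hkj : k < j := by
    by_contra hkj
    have := cnt_mono h (R.proc k) (show j ≤ k + 1 by omega)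
    simp only at this
    omega
  have hex : ∃ m, k < m ∧ R.trace.proc m = R.trace.proc k ∧ (R.trace.out m).isSome := by
    by_contra hno
    have := (pending h he hkj fun m hm _ hp => ?_).2.1
    · omega
    · by_contra hne
      exact hno ⟨m, hm, hp, Option.isSome_iff_ne_none.2 hne⟩
  obtain ⟨h1, h2, h3⟩ := Nat.find_spec hex
  obtain ⟨r, hr⟩ := Option.isSome_iff_exists.1 h3
  refine ⟨Nat.find hex, r, hk, h1, h2, hr, fun m hm hml hp => ?_⟩
  by_contra hne
  exact Nat.find_min hex hml ⟨hm, hp, Option.isSome_iff_ne_none.2 hne⟩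

/-- A transfer known to a process when it invokes an operation that returns becomes known to all
correct processes. -/
theorem known_of_returns {k l : ℕ} {r : MTRes} (hr : R.trace.Returns k l r) {f : MTEntry n}
    (hf : f ∈ log R (k + 1) (R.proc k)) (ht : f.toOp.isTransfer = true) {q : Fin n}
    (hq : R.trace.Correct q) : ∃ j, f ∈ log R j q := by
  obtain ⟨e, -, -, hc⟩ := returns_spec h hr
  obtain ⟨m, m', hm, -, hmp, rfl, hm'⟩ :=
    exists_receive_of_cnt h (by have := hr.2.1; omega) hc hq
  refine ⟨m' + 1, ?_⟩
  rw [log_of_receive h hm', mem_merge, hmp]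
  exact .inr ⟨mem_log_mono h hm hf, ht⟩

theorem known_of_known {p q : Fin n} (hp : R.trace.Correct p) (hq : R.trace.Correct q) {k : ℕ}
    {f : MTEntry n} (hf : f ∈ log R k p) (ht : f.toOp.isTransfer = true) :
    ∃ j, f ∈ log R j q := by
  obtain ⟨m, m', hm, hmp, rfl, hm'⟩ := exists_receive h hp hq k
  refine ⟨m' + 1, ?_⟩
  rw [log_of_receive h hm', mem_merge, hmp]
  exact .inr ⟨mem_log_mono h hm hf, ht⟩

end

end MT

end CAMP

/-! ### The history of a run and the serializations of its views. -/

namespace CAMP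

namespace MT

open Gossip MTEntry

variable {n t : ℕ} {init : Fin n → ℝ} {R : Run (mtGossip init).alg}

theorem entryAt_cases {k : ℕ} {e : MTEntry n} (he : entryAt R k = some e) :
    (∃ j, e.op = .balance j ∧ e.res = .value (balance init (log R k (R.proc k)) j)) ∨
    ∃ d v, e.op = .transfer d v ∧ (e.res = .commit ∨
      e.res = .abort ∧ balance init (log R k (R.proc k)) (R.proc k) < v) := by
  obtain ⟨o, -, rfl⟩ := entryAt_eq_some.1 he
  cases o with
  | balance j => exact .inl ⟨j, rfl, rfl⟩
  | transfer d v =>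
    refine .inr ⟨d, v, rfl, ?_⟩
    simp only [MTEntry.new]
    split_ifs with hv
    · exact .inl rfl
    · exact .inr ⟨rfl, not_le.1 hv⟩

theorem sum_range_getElem? (f : Operation n (MTOp n) MTRes → ℝ) (l : List (MTEntry n)) (x : ℕ) :
    ∑ y ∈ Finset.range x, ((l[y]?.map toOp).elim 0 f) =
      ((l.take x).map fun e => f e.toOp).sum := by
  induction x with
  | zero => simp
  | succ x ih =>
    rw [Finset.sum_range_succ, ih, List.take_add_one]
    cases l[x]? <;> simp

/-- The operation invoked in event `k` stands at position `x` of the log of `i`. -/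
def At (R : Run (mtGossip init).alg) (i : Fin n) (x k : ℕ) : Prop :=
  ∃ j e, (log R j i)[x]? = some e ∧ entryAt R k = some e

/-- The operations that take effect: those that return, and the transfers that become known to
correct processes. -/
def InHist (R : Run (mtGossip init).alg) (k : ℕ) : Prop :=
  (∃ l r, R.trace.Returns k l r) ∨
    ∃ e, entryAt R k = some e ∧ e.toOp.isTransfer = true ∧
      ∃ q, R.trace.Correct q ∧ ∃ j, e ∈ log R j q

open Classical in
noncomputable def hist (R : Run (mtGossip init).alg) : History n (MTOp n) MTRes := fun k =>
  if InHist R k then (entryAt R k).map toOp else none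

/-- The log of a faulty process is considered up to the last operation of this process that takes
effect. -/
def Active (R : Run (mtGossip init).alg) (i : Fin n) (x : ℕ) : Prop :=
  R.trace.Correct i ∨ ∃ y k, x ≤ y ∧ At R i y k ∧ R.proc k = i ∧ InHist R k

/-- The operations that stand in the considered part of the log of `i`. -/
def Seen (R : Run (mtGossip init).alg) (i : Fin n) (k : ℕ) : Prop :=
  ∃ x, At R i x k ∧ Active R i x

theorem hist_eq_some {k : ℕ} {a : Operation n (MTOp n) MTRes} :
    hist R k = some a ↔ InHist R k ∧ ∃ e, entryAt R k = some e ∧ e.toOp = a := by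
  unfold hist
  split_ifs with hk <;> simp [hk]

theorem Active.mono {i : Fin n} {x y : ℕ} (hx : Active R i x) (hyx : y ≤ x) : Active R i y := by
  rcases hx with hx | ⟨z, k, hz, hk⟩
  · exact .inl hx
  · exact .inr ⟨z, k, hyx.trans hz, hk⟩

section

variable (h : R.IsExecution t mtAllowed)
include h

omit h in
theorem At.op_unique (h : R.IsExecution t mtAllowed) {i : Fin n} {x k k' : ℕ} (hk : At R i x k)
    (hk' : At R i x k') : k = k' := by
  obtain ⟨j, e, hj, hje⟩ := hk
  obtain ⟨j', e', hj', hje'⟩ := hk'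
  have h1 := log_getElem? h (le_max_left j j') hj
  have h2 := log_getElem? h (le_max_right j j') hj'
  rw [h1] at h2
  cases h2
  exact entryAt_inj h hje hje'

omit h in
theorem At.pos_unique (h : R.IsExecution t mtAllowed) {i : Fin n} {x x' k : ℕ} (hk : At R i x k)
    (hk' : At R i x' k) : x = x' := by
  obtain ⟨j, e, hj, hje⟩ := hk
  obtain ⟨j', e', hj', hje'⟩ := hk'
  rw [hje] at hje'
  cases hje'
  exact MT.pos_unique h hj hj'

omit h in
theorem at_of_mem {i : Fin n} {j k : ℕ} {e : MTEntry n} (he : entryAt R k = some e)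
    (hj : e ∈ log R j i) : ∃ x, At R i x k := by
  obtain ⟨x, hx⟩ := List.mem_iff_getElem?.1 hj
  exact ⟨x, j, e, hx, he⟩

omit h in
theorem at_of_mem_take {i : Fin n} {j k x : ℕ} {e : MTEntry n} (he : entryAt R k = some e)
    (hj : e ∈ (log R j i).take x) : ∃ y < x, At R i y k := by
  obtain ⟨y, hy⟩ := List.mem_iff_getElem?.1 hj
  rw [List.getElem?_take] at hy
  split_ifs at hy with hyx
  exact ⟨y, hyx, j, e, hy, he⟩

/-- Operations of one process stand in each log in the order of their invocation. -/
theorem at_of_earlier {i : Fin n} {x k k' : ℕ} {e' : MTEntry n} (hx : At R i x k) (hkk : k' < k)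
    (hp : R.proc k' = R.proc k) (he' : entryAt R k' = some e')
    (hi : R.proc k = i ∨ e'.toOp.isTransfer = true) : ∃ y < x, At R i y k' := by
  obtain ⟨j, e, hj, he⟩ := hx
  have hmem := mem_log_of_entryAt h he' hkk
  refine at_of_mem_take he' (j := j) ?_
  rcases hi with hi | hi
  · rwa [take_of_own h hj he hi, ← hi, ← hp]
  · refine ((good_log h j i).spec hj).2 e' ⟨hi, k, he, ?_⟩
    rwa [entryAt_src he, ← hp]

/-- Its own position witnesses that it belongs to the considered part of the log, also if the
process is faulty. -/
theorem seen_own {k : ℕ} (hk : InHist R k) : Seen R (R.proc k) k := by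
  obtain ⟨e, he⟩ : ∃ e, entryAt R k = some e := by
    rcases hk with ⟨l, r, hr⟩ | ⟨e, he, -⟩
    · obtain ⟨e, he, -⟩ := returns_spec h hr
      exact ⟨e, he⟩
    · exact ⟨e, he⟩
  obtain ⟨x, hx⟩ := at_of_mem he (mem_log_of_entryAt h he k.lt_succ_self)
  exact ⟨x, hx, .inr ⟨x, k, le_rfl, hx, rfl, hk⟩⟩

/-- Transfers that take effect become known to all correct processes. -/
theorem known_of_inHist {k : ℕ} {e : MTEntry n} (hk : InHist R k) (he : entryAt R k = some e)
    (ht : e.toOp.isTransfer = true) {q : Fin n} (hq : R.trace.Correct q) :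
    ∃ j, e ∈ log R j q := by
  rcases hk with ⟨l, r, hr⟩ | ⟨e', he', -, p, hp, j, hj⟩
  · exact known_of_returns h hr (mem_log_of_entryAt h he k.lt_succ_self) ht hq
  · rw [he] at he'
    cases he'
    exact known_of_known h hp hq hj ht

/-- This is why cutting the log of a faulty process suffices: an operation that takes effect drags
along everything its issuer knew, so no seen transfer is lost with a crashed process. -/
theorem inHist_of_seen (htn : t < n) {i : Fin n} {k : ℕ} (hk : Seen R i k) : InHist R k := by
  obtain ⟨x, hx, hact⟩ := hk
  have hinv : ∀ {k e}, entryAt R k = some e → (R.trace.inv k).isSome := by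
    intro k e he
    obtain ⟨o, ho, -⟩ := entryAt_eq_some.1 he
    rw [trace_inv.2 ho]
    rfl
  obtain ⟨j, e, hj, he⟩ := hx
  have hmem := List.mem_of_getElem? hj
  rcases hact with hi | ⟨y, k', hxy, hy, hki, hk'⟩
  · by_cases hki : R.proc k = i
    · exact .inl (terminates h k (hinv he) (show R.trace.Correct (R.proc k) by rwa [hki]))
    · refine .inr ⟨e, he, (exists_entryAt h hmem).2.resolve_left ?_, i, hi, j, hmem⟩
      rwa [entryAt_src he]
  · obtain ⟨j', e', hj', he'⟩ := hy
    rcases hxy.eq_or_lt with rfl | hxy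
    · rwa [At.op_unique h ⟨j, e, hj, he⟩ ⟨j', e', hj', he'⟩]
    · have hmem' : e ∈ log R k' i := by
        rw [← take_of_own h (log_getElem? h (le_max_right j j') hj') he' hki]
        refine List.mem_iff_getElem?.2 ⟨x, ?_⟩
        rw [List.getElem?_take_of_lt hxy]
        exact log_getElem? h (le_max_left j j') hj
      obtain ⟨⟨k1, hk1, he1⟩, hor⟩ := exists_entryAt h hmem'
      rw [entryAt_inj h he1 he] at hk1
      -- An own operation before `k'` has returned, because processes are sequential. A foreign one
      -- is a transfer that `i` knew when it invoked `k'`.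
      by_cases hki' : R.proc k = i
      · obtain ⟨l, r, hr, -⟩ := h.properUse.2 k k' hk1 (hki'.trans hki.symm) (hinv he) (hinv he')
        exact .inl ⟨l, r, hr⟩
      · rw [entryAt_src he] at hor
        have ht := hor.resolve_left hki'
        obtain ⟨q, hq⟩ := h.exists_correct htn
        refine .inr ⟨e, he, ht, q, hq, ?_⟩
        rw [← hki] at hmem'
        -- If `k'` returned, the log of `i` was sent to everybody first. Otherwise `k'` is a
        -- transfer known to a correct process, whose log contains the dependencies of `k'`.
        rcases hk' with ⟨l, r, hr⟩ | ⟨e2, he2, -, p, hp, j2, hj2⟩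
        · exact known_of_returns h hr (mem_log_mono h k'.le_succ hmem') ht hq
        · rw [he'] at he2
          cases he2
          obtain ⟨z, hz⟩ := List.mem_iff_getElem?.1 hj2
          have := ((good_log h j2 p).spec hz).2 e ⟨ht, k', he', by rwa [entryAt_src he']⟩
          exact known_of_known h hp hq (List.take_subset _ _ this) ht

omit h in
theorem viewOf_eq_some {i : Fin n} {H : History n (MTOp n) MTRes} {k : ℕ}
    {a : Operation n (MTOp n) MTRes} :
    viewOf i H k = some a ↔ H k = some a ∧ (a.proc = i ∨ a.isTransfer = true) := by
  simp [viewOf, Option.filter_eq_some_iff]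

/-- The considered part of the log of `i`, read in the limit of time, is the serialization. The
second hypothesis says that `H` is chosen so that the view of `i` consists of exactly these
operations. -/
theorem hasMTSerialization {i : Fin n} {H : History n (MTOp n) MTRes}
    (hsub : ∀ k a, H k = some a → hist R k = some a)
    (hseen : ∀ k, (viewOf i H k).isSome ↔ Seen R i k) : HasMTSerialization init i H := by
  have hentry : ∀ {k a}, viewOf i H k = some a → ∃ e, entryAt R k = some e ∧ e.toOp = a :=
    fun hk => (hist_eq_some.1 (hsub _ _ (viewOf_eq_some.1 hk).1)).2
  have hview : ∀ {k e}, Seen R i k → entryAt R k = some e → viewOf i H k = some e.toOp := by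
    intro k e hk he
    obtain ⟨a, ha⟩ := Option.isSome_iff_exists.1 ((hseen k).2 hk)
    obtain ⟨e', he', rfl⟩ := hentry ha
    rw [he] at he'
    cases he'
    exact ha
  obtain ⟨S, hS⟩ := exists_sequence (fun x k => At R i x k ∧ Active R i x)
    fun x k k' hk hk' => At.op_unique h hk.1 hk'.1
  refine ⟨S, ⟨?_, ?_, ?_⟩, ?_⟩
  · intro x k hx
    rw [hseen]
    exact ⟨x, (hS x k).1 hx⟩
  · intro k hk
    obtain ⟨x, hx⟩ := (hseen k).1 hk
    exact ⟨x, (hS x k).2 hx, fun y hy => At.pos_unique h ((hS y k).1 hy).1 hx.1⟩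
  · rintro x x' k k' hx hx' ⟨hkk, a, a', ha, ha', hp⟩
    obtain ⟨e, he, rfl⟩ := hentry ha
    obtain ⟨e', he', rfl⟩ := hentry ha'
    have hp' : R.proc k = R.proc k' := by rwa [← entryAt_src he, ← entryAt_src he']
    obtain ⟨y, hy, hyk⟩ := at_of_earlier h ((hS x' k').1 hx').1 hkk hp' he (by
      refine (viewOf_eq_some.1 ha).2.imp_left fun hi => ?_
      rw [← hp', ← entryAt_src he]
      exact hi)
    rwa [At.pos_unique h ((hS x k).1 hx).1 hyk]
  · intro x k a hx ha
    obtain ⟨e, he, rfl⟩ := hentry ha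
    obtain ⟨⟨j, e', hj, he'⟩, hact⟩ := (hS x k).1 hx
    rw [he] at he'
    cases he'
    -- No slot before `x` is empty, so the account at position `x` is the balance of the log prefix
    -- of length `x`.
    have hacc : ∀ d, acc init (viewOf i H) S d x = balance init ((log R j i).take x) d := by
      intro d
      have : ∀ y ∈ Finset.range x, (S y).bind (viewOf i H) = (log R j i)[y]?.map toOp := by
        intro y hy
        have hyx := Finset.mem_range.1 hy
        obtain ⟨f, hf⟩ : ∃ f, (log R j i)[y]? = some f :=
          ⟨_, List.getElem?_eq_getElem (hyx.trans (List.getElem?_eq_some_iff.1 hj).1)⟩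
        obtain ⟨⟨k', -, hk'⟩, -⟩ := exists_entryAt h (List.mem_of_getElem? hf)
        have hyk : At R i y k' ∧ Active R i y := ⟨⟨j, f, hf, hk'⟩, hact.mono hyx.le⟩
        rw [(hS y k').2 hyk, hf]
        exact hview ⟨y, hyk⟩ hk'
      have hsum : ∀ f : Operation n (MTOp n) MTRes → ℝ,
          ∑ y ∈ Finset.range x, ((S y).bind (viewOf i H)).elim 0 f =
            ∑ y ∈ Finset.range x, ((log R j i)[y]?.map toOp).elim 0 f :=
        fun f => Finset.sum_congr rfl fun y hy => by rw [this y hy]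
      rw [acc, balance, hsum, hsum, sum_range_getElem?, sum_range_getElem?]
    have hor := (viewOf_eq_some.1 ha).2
    -- Balances and aborted transfers in the view belong to `i` itself, which decided them on
    -- exactly this prefix.
    have hown : ¬ e.toOp.isTransfer = true →
        (log R j i).take x = log R k (R.proc k) ∧ e.toOp.proc = R.proc k := by
      intro hnt
      have hi : R.proc k = i := (entryAt_src he).symm.trans (hor.resolve_right hnt)
      exact ⟨(take_of_own h hj he hi).trans (by rw [hi]), entryAt_src he⟩
    simp only [hacc]
    rcases entryAt_cases he with ⟨d, hop, hres⟩ | ⟨d, v, hop, hres | ⟨hres, hv⟩⟩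
    · rw [(hown (by rw [isTransfer_iff]; simp [toOp, hop])).1]
      simp [toOp, hop, hres]
    · have := le_balance h hj hop hres
      simpa [toOp, hop, hres] using this
    · have := hown (by rw [isTransfer_iff]; simp [toOp, hres])
      rw [this.1, this.2]
      simpa [toOp, hop, hres] using hv

/-- What the faulty process `i` sees of the other processes. -/
theorem exists_prefix (htn : t < n) (i : Fin n) :
    ∃ H, IsPrefixExcept i H (hist R) ∧ HasMTSerialization init i H := by
  classical
  -- From every other process, keep everything up to its last operation seen by `i`; this is closed
  -- under prefixes by construction.
  let P : ℕ → Prop := fun k =>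
    R.proc k = i ∨ ∃ k', k ≤ k' ∧ R.proc k' = R.proc k ∧ Seen R i k'
  have hH : ∀ k a, (if P k then hist R k else none) = some a ↔ P k ∧ hist R k = some a := by
    intro k a
    split_ifs with hP <;> simp [hP]
  have hproc : ∀ {k a}, hist R k = some a → a.proc = R.proc k := by
    intro k a ha
    obtain ⟨-, e, he, rfl⟩ := hist_eq_some.1 ha
    exact entryAt_src he
  refine ⟨fun k => if P k then hist R k else none, ⟨?_, ?_, ?_⟩, hasMTSerialization h ?_ ?_⟩
  · exact fun k a ha => ((hH k a).1 ha).2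
  · exact fun k a ha hi => (hH k a).2 ⟨.inl ((hproc ha).symm.trans hi), ha⟩
  · rintro k k' ⟨hkk, a, a', ha, ha', hp⟩ hk'
    obtain ⟨b, hb⟩ := Option.isSome_iff_exists.1 hk'
    rw [hproc ha, hproc ha'] at hp
    refine Option.isSome_iff_exists.2 ⟨a, (hH k a).2 ⟨?_, ha⟩⟩
    rcases ((hH k' b).1 hb).1 with hi | ⟨k2, hk2, hp2, hs⟩
    · exact .inl (hp.trans hi)
    · exact .inr ⟨k2, hkk.le.trans hk2, hp2.trans hp.symm, hs⟩
  · exact fun k a ha => ((hH k a).1 ha).2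
  · intro k
    constructor
    · intro hk
      obtain ⟨a, ha⟩ := Option.isSome_iff_exists.1 hk
      rw [viewOf_eq_some, hH] at ha
      obtain ⟨⟨hP, ha⟩, hor⟩ := ha
      obtain ⟨hin, e, he, rfl⟩ := hist_eq_some.1 ha
      by_cases hi : R.proc k = i
      · exact hi ▸ seen_own h hin
      · have ht := hor.resolve_left fun hc => hi ((entryAt_src he).symm.trans hc)
        obtain ⟨k2, hk2, hp2, x, hx, hact⟩ := hP.resolve_left hi
        rcases hk2.eq_or_lt with rfl | hk2
        · exact ⟨x, hx, hact⟩
        -- The kept prefix brings in no unseen transfer: an earlier transfer of the same process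
        -- stands before the seen operation in the log of `i`.
        · obtain ⟨y, hy, hyk⟩ := at_of_earlier h hx hk2 hp2.symm he (.inr ht)
          exact ⟨y, hyk, hact.mono hy.le⟩
    · intro hk
      have hin := inHist_of_seen h htn hk
      obtain ⟨x, ⟨j, e, hj, he⟩, -⟩ := id hk
      refine Option.isSome_iff_exists.2 ⟨e.toOp, viewOf_eq_some.2 ⟨(hH _ _).2
        ⟨.inr ⟨k, le_rfl, rfl, hk⟩, hist_eq_some.2 ⟨hin, e, he, rfl⟩⟩, ?_⟩⟩
      exact (exists_entryAt h (List.mem_of_getElem? hj)).2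

theorem hasMTSerialization_of_correct (htn : t < n) {i : Fin n} (hi : R.trace.Correct i) :
    HasMTSerialization init i (hist R) := by
  refine hasMTSerialization h (fun _ _ => id) fun k => ⟨fun hk => ?_, fun hk => ?_⟩
  · obtain ⟨a, ha⟩ := Option.isSome_iff_exists.1 hk
    obtain ⟨ha, hor⟩ := viewOf_eq_some.1 ha
    obtain ⟨hin, e, he, rfl⟩ := hist_eq_some.1 ha
    rcases hor with hp | ht
    · obtain rfl : R.proc k = i := (entryAt_src he).symm.trans hp
      exact seen_own h hin
    · obtain ⟨j, hj⟩ := known_of_inHist h hin he ht hi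
      obtain ⟨x, hx⟩ := at_of_mem he hj
      exact ⟨x, hx, .inl hi⟩
  · have hin := inHist_of_seen h htn hk
    obtain ⟨x, ⟨j, e, hj, he⟩, -⟩ := hk
    exact Option.isSome_iff_exists.2 ⟨e.toOp, viewOf_eq_some.2
      ⟨hist_eq_some.2 ⟨hin, e, he, rfl⟩, (exists_entryAt h (List.mem_of_getElem? hj)).2⟩⟩

theorem isHistoryOf_hist : IsHistoryOf (hist R) R.trace := by
  refine ⟨fun k a ha => ?_, fun k l r hr => ?_⟩
  · obtain ⟨-, e, he, rfl⟩ := hist_eq_some.1 ha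
    obtain ⟨o, ho, rfl⟩ := entryAt_eq_some.1 he
    exact ⟨rfl, trace_inv.2 ho⟩
  · obtain ⟨e, he, hres, -⟩ := returns_spec h hr
    exact ⟨e.toOp, hist_eq_some.2 ⟨.inl ⟨l, r, hr⟩, e, he, rfl⟩, hres⟩

end

end MT

theorem moneyTransferSolvable {n t : ℕ} (ht : t < n) : MoneyTransferSolvable n t :=
  fun init _ => ⟨(mtGossip init).alg, fun R h => ⟨MT.terminates h, MT.hist R,
    MT.isHistoryOf_hist h, fun _ => MT.hasMTSerialization_of_correct h ht,
    fun i _ => MT.exists_prefix h ht i⟩⟩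

end CAMP

namespace CAMP

variable {n : ℕ} {Inv Res : Type}

/-! ### Construction of runs -/

namespace Run

variable {A : Algorithm n Inv Res}

/-- The runs `R` and `R'` have the same first `K` events. -/
structure Agree (R R' : Run A) (K : ℕ) : Prop where
  proc : ∀ k < K, R.proc k = R'.proc k
  act : ∀ k < K, R.act k = R'.act k
  state : ∀ k ≤ K, R.state k = R'.state k

namespace Agree

variable {R R' R'' : Run A} {K K' k : ℕ}

theorem refl (R : Run A) (K : ℕ) : Agree R R K := ⟨fun _ _ => rfl, fun _ _ => rfl, fun _ _ => rfl⟩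

theorem trans (h : Agree R R' K) (h' : Agree R' R'' K) : Agree R R'' K :=
  ⟨fun k hk => (h.proc k hk).trans (h'.proc k hk), fun k hk => (h.act k hk).trans (h'.act k hk),
    fun k hk => (h.state k hk).trans (h'.state k hk)⟩

theorem mono (h : Agree R R' K) (hK : K' ≤ K) : Agree R R' K' :=
  ⟨fun k hk => h.proc k (hk.trans_le hK), fun k hk => h.act k (hk.trans_le hK),
    fun k hk => h.state k (hk.trans hK)⟩

theorem sent (h : Agree R R' K) (hk : k < K) : R.sent k = R'.sent k := by
  simp only [Run.sent, h.proc k hk, h.act k hk, h.state k hk.le]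

theorem out (h : Agree R R' K) (hk : k < K) : R.trace.out k = R'.trace.out k := by
  simp only [Run.trace, h.proc k hk, h.act k hk, h.state k hk.le]

theorem inv (h : Agree R R' K) (hk : k < K) : R.trace.inv k = R'.trace.inv k := by
  simp only [Run.trace, h.act k hk]

theorem isStep (h : Agree R R' K) (hk : k < K) (hs : R.IsStep k) : R'.IsStep k := by
  unfold Run.IsStep at hs ⊢
  rw [← h.act k hk, ← h.proc k hk, ← h.state k hk.le, ← h.state (k + 1) hk]
  cases ha : R.act k with
  | invoke o => simpa [ha] using hs
  | compute => simpa [ha] using hs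
  | receive s =>
    simp only [ha] at hs ⊢
    rwa [← h.sent (hs.1.trans hk), ← h.proc s (hs.1.trans hk)]

theorem returns (h : Agree R R' K) {l : ℕ} {r : Res} (hl : l < K) (hr : R.trace.Returns k l r) :
    R'.trace.Returns k l r := by
  obtain ⟨h1, h2, h3, h4, h5⟩ := hr
  have hk := h2.trans hl
  refine ⟨by rwa [← h.inv hk], h2, ?_, by rwa [← h.out hl], fun m hm hml hp => ?_⟩
  · exact (h.proc l hl).symm.trans (h3.trans (h.proc k hk))
  · rw [← h.out (hml.trans hl)]
    exact h5 m hm hml ((h.proc m (hml.trans hl)).trans (hp.trans (h.proc k hk).symm))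

end Agree

/-- The states after the process `p` has done `a` in event `k`. -/
def next (R : Run A) (k : ℕ) (p : Fin n) (a : Action Inv) : Fin n → A.State :=
  match a with
  | .invoke o => Function.update (R.state k) p (A.invoke p (R.state k p) o)
  | .receive s =>
    match R.sent s with
    | some (_, m) => Function.update (R.state k) p (A.receive p (R.state k p) (R.proc s) m)
    | none => R.state k
  | .compute => Function.update (R.state k) p (A.compute p (R.state k p)).1

/-- Replace the `k`-th event. -/
def ext (R : Run A) (k : ℕ) (p : Fin n) (a : Action Inv) : Run A where
  proc := Function.update R.proc k p
  act := Function.update R.act k a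
  state := Function.update R.state (k + 1) (R.next k p a)

theorem agree_ext (R : Run A) (k : ℕ) (p : Fin n) (a : Action Inv) :
    Agree R (R.ext k p a) k where
  proc j hj := (Function.update_of_ne hj.ne _ _).symm
  act j hj := (Function.update_of_ne hj.ne _ _).symm
  state j hj := (Function.update_of_ne (by omega) _ _).symm

theorem isStep_ext (R : Run A) (k : ℕ) (p : Fin n) (a : Action Inv)
    (ha : ∀ s, a = .receive s → s < k ∧ ∃ m, R.sent s = some (p, m)) :
    (R.ext k p a).IsStep k := by
  have hag := R.agree_ext k p a
  have h1 : (R.ext k p a).act k = a := Function.update_self _ _ _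
  have h2 : (R.ext k p a).proc k = p := Function.update_self _ _ _
  have h3 : (R.ext k p a).state (k + 1) = R.next k p a := Function.update_self _ _ _
  unfold IsStep
  rw [h1, h2, h3, ← hag.state k le_rfl]
  cases a with
  | invoke o => rfl
  | compute => rfl
  | receive s =>
    obtain ⟨hs, m, hm⟩ := ha s rfl
    refine ⟨hs, m, by rwa [← hag.sent hs], ?_⟩
    rw [← hag.proc s hs]
    simp [next, hm]

/-- Every finite sequence of events can be continued fairly, with a given set `C` of correct
processes and without further invocations. -/
theorem exists_extension {t : ℕ} {allowed : Fin n → Inv → Prop} (R₀ : Run A) (K : ℕ)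
    (start : R₀.state 0 = A.start) (step : ∀ k < K, R₀.IsStep k)
    (nodup : ∀ s k k', k < K → k' < K → R₀.act k = .receive s → R₀.act k' = .receive s → k = k')
    (C : Set (Fin n)) (hC : C.Nonempty) (ht : Cᶜ.ncard ≤ t) :
    ∃ R : Run A, Agree R₀ R K ∧ (∀ k, K ≤ k → R.proc k ∈ C ∧ ∀ o, R.act k ≠ .invoke o) ∧
      (∀ p ∈ C, R.trace.Correct p) ∧ (R.trace.ProperUse allowed → R.IsExecution t allowed) := by
  classical
  obtain ⟨c, hc⟩ := hC
  -- Tasks are computation steps of processes and deliveries of messages. Event `k` attends to task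
  -- `f k.unpair.1`, so each task recurs beyond every bound. If it cannot be done, the process `c`
  -- computes instead.
  obtain ⟨f, hf⟩ := exists_surjective_nat (Fin n ⊕ ℕ)
  have hev : ∀ (k : ℕ) (R : Run A), ∃ e : Fin n × Action Inv, e.1 ∈ C ∧ (∀ o, e.2 ≠ .invoke o) ∧
      (∀ s, e.2 = .receive s → s < k ∧ (∃ m, R.sent s = some (e.1, m)) ∧
        ∀ k' < k, R.act k' ≠ .receive s) ∧
      (∀ p ∈ C, f k.unpair.1 = .inl p → e = (p, .compute)) ∧
      ∀ s q m, f k.unpair.1 = .inr s → s < k → R.sent s = some (q, m) → q ∈ C →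
        (∀ k' < k, R.act k' ≠ .receive s) → e.2 = .receive s := by
    intro k R
    cases hfk : f k.unpair.1 with
    | inl p =>
      by_cases hp : p ∈ C
      · exact ⟨(p, .compute), hp, by simp, by simp, by simp, by simp⟩
      · refine ⟨(c, .compute), hc, by simp, by simp, ?_, by simp⟩
        rintro p' hp' h
        cases h
        exact absurd hp' hp
    | inr s =>
      by_cases hs : ∃ q m, s < k ∧ R.sent s = some (q, m) ∧ q ∈ C ∧
          ∀ k' < k, R.act k' ≠ .receive s
      · obtain ⟨q, m, h1, h2, h3, h4⟩ := hs
        refine ⟨(q, .receive s), h3, by simp, ?_, by simp, ?_⟩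
        · rintro s' h
          cases h
          exact ⟨h1, ⟨m, h2⟩, h4⟩
        · rintro s' q' m' h - - - -
          cases h
          rfl
      · refine ⟨(c, .compute), hc, by simp, by simp, by simp, ?_⟩
        rintro s' q' m' h h1 h2 h3 h4
        cases h
        exact absurd ⟨q', m', h1, h2, h3, h4⟩ hs
  choose ev hev1 hev2 hev3 hev4 hev5 using hev
  -- `F k` has its first `k` events right. As `F (k + 1)` changes nothing before event `k`, the
  -- diagonal run `R` agrees with each `F k` up to `k`.
  let F : ℕ → Run A := fun k => Nat.rec R₀
    (fun k R => if k < K then R else R.ext k (ev k R).1 (ev k R).2) k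
  have hF : ∀ k, F (k + 1) = if k < K then F k else (F k).ext k (ev k (F k)).1 (ev k (F k)).2 :=
    fun _ => rfl
  have hF0 : ∀ k, k ≤ K → F k = R₀ := by
    intro k hk
    induction k with
    | zero => rfl
    | succ k ih => rw [hF, if_pos (Nat.lt_of_succ_le hk), ih (Nat.le_of_succ_le hk)]
  have hag : ∀ {k j}, k ≤ j → Agree (F k) (F j) k := by
    intro k j hkj
    induction hkj with
    | refl => exact Agree.refl _ _
    | @step j hkj ih =>
      refine ih.trans ?_
      rw [Nat.succ_eq_add_one, hF]
      split_ifs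
      · exact Agree.refl _ _
      · exact (agree_ext _ _ _ _).mono hkj
  let R : Run A := ⟨fun k => (F (k + 1)).proc k, fun k => (F (k + 1)).act k, fun k => (F k).state k⟩
  have hR : ∀ k, Agree (F k) R k := fun k =>
    ⟨fun j hj => ((hag hj).proc j j.lt_succ_self).symm,
      fun j hj => ((hag hj).act j j.lt_succ_self).symm,
      fun j hj => ((hag hj).state j le_rfl).symm⟩
  have hR0 : Agree R₀ R K := hF0 K le_rfl ▸ hR K
  have hproc : ∀ k, K ≤ k → R.proc k = (ev k (F k)).1 := by
    intro k hk
    change (F (k + 1)).proc k = _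
    rw [hF, if_neg hk.not_gt]
    exact Function.update_self _ _ _
  have hact : ∀ k, K ≤ k → R.act k = (ev k (F k)).2 := by
    intro k hk
    change (F (k + 1)).act k = _
    rw [hF, if_neg hk.not_gt]
    exact Function.update_self _ _ _
  have hC' : ∀ k, K ≤ k → R.proc k ∈ C := fun k hk => hproc k hk ▸ hev1 _ _
  have hprog : ∀ p ∈ C, ∀ K', ∃ k, K' ≤ k ∧ R.proc k = p ∧ R.act k = .compute := by
    intro p hp K'
    obtain ⟨a, ha⟩ := hf (.inl p)
    have hk := Nat.right_le_pair a (max K K')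
    have h1 := (le_max_left _ _).trans hk
    have := hev4 (Nat.pair a (max K K')) (F (Nat.pair a (max K K'))) p hp (by rw [Nat.unpair_pair, ha])
    exact ⟨_, (le_max_right _ _).trans hk, by rw [hproc _ h1, this], by rw [hact _ h1, this]⟩
  have hcor : ∀ {p}, R.trace.Correct p → p ∈ C := by
    intro p hp
    by_contra hpC
    exact hp ⟨K, fun k hk he => hpC (he ▸ hC' k hk)⟩
  have hcor' : ∀ p ∈ C, R.trace.Correct p := by
    rintro p hp ⟨K', hK'⟩
    obtain ⟨k, hk, hkp, -⟩ := hprog p hp K'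
    exact hK' k hk hkp
  refine ⟨R, hR0, fun k hk => ⟨hC' k hk, fun o => by rw [hact k hk]; exact hev2 _ _ _⟩, hcor',
    fun hpu => ⟨?_, ?_, hpu, ?_, ?_, ?_, ?_⟩⟩
  · rw [← hR0.state 0 K.zero_le, start]
  · intro k
    by_cases hk : k < K
    · exact hR0.isStep hk (step k hk)
    · refine (hR (k + 1)).isStep k.lt_succ_self ?_
      rw [hF, if_neg hk]
      exact isStep_ext _ _ _ _ fun s hs => ⟨(hev3 _ _ s hs).1, (hev3 _ _ s hs).2.1⟩
  · refine (Set.ncard_le_ncard ?_ (Set.toFinite _)).trans ht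
    exact fun p hp hpC => hcor' p hpC hp
  · exact fun p hp => hprog p (hcor hp)
  · have key : ∀ s k k', k < k' → R.act k = .receive s → R.act k' ≠ .receive s := by
      intro s k k' hkk hk hk'
      by_cases hK : k' < K
      · refine hkk.ne (nodup s k k' (hkk.trans hK) hK ?_ ?_)
        · rwa [hR0.act k (hkk.trans hK)]
        · rwa [hR0.act k' hK]
      · rw [hact k' (not_lt.1 hK)] at hk'
        refine (hev3 _ _ s hk').2.2 k hkk ?_
        rwa [(hR k').act k hkk]
    intro s k k' hk hk'
    rcases lt_trichotomy k k' with hlt | heq | hgt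
    · exact absurd hk' (key s k k' hlt hk)
    · exact heq
    · exact absurd hk (key s k' k hgt hk')
  · intro s q m hs hq
    by_contra hno
    obtain ⟨a, ha⟩ := hf (.inr s)
    have hk := Nat.right_le_pair a (max K (s + 1))
    have h1 := (le_max_left _ _).trans hk
    have h2 : s < Nat.pair a (max K (s + 1)) := (le_max_right _ _).trans hk
    refine hno ⟨_, (hact _ h1).trans
      (hev5 _ _ s q m (by rw [Nat.unpair_pair, ha]) h2 ?_ (hcor hq) ?_)⟩
    · rwa [(hR _).sent h2]
    · intro k' hk' he
      rw [(hR _).act k' hk'] at he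
      exact hno ⟨k', he⟩

/-- Executions in which only one operation is invoked, and the other processes outside `C` take
no steps. -/
theorem exists_solo (A : Algorithm n Inv Res) {t : ℕ} {allowed : Fin n → Inv → Prop}
    (C : Set (Fin n)) (ht : Cᶜ.ncard ≤ t) {p : Fin n} (hp : p ∈ C) {o : Inv} (ho : allowed p o) :
    ∃ R : Run A, R.IsExecution t allowed ∧ R.proc 0 = p ∧ R.act 0 = .invoke o ∧
      (∀ k, R.proc k ∈ C) ∧ R.trace.Correct p ∧ ∀ k o', R.act k = .invoke o' → k = 0 := by
  let R₁ : Run A := ⟨fun _ => p, fun _ => .compute, fun _ => A.start⟩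
  obtain ⟨R, hag, hR, hcor, hex⟩ := exists_extension (t := t) (allowed := allowed)
    (R₁.ext 0 p (.invoke o)) 1 rfl
    (fun k hk => by
      obtain rfl : k = 0 := by omega
      exact isStep_ext _ _ _ _ (by simp))
    (by intros; omega) C ⟨p, hp⟩ ht
  have h0 : R.proc 0 = p := (hag.proc 0 one_pos).symm
  have h1 : R.act 0 = .invoke o := (hag.act 0 one_pos).symm
  have h2 : ∀ k o', R.act k = .invoke o' → k = 0 := by
    intro k o' hk
    by_contra hne
    exact (hR k (Nat.one_le_iff_ne_zero.2 hne)).2 o' hk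
  have h3 : ∀ k o', R.trace.inv k = some o' → k = 0 ∧ o' = o := by
    intro k o' hk
    have : R.act k = .invoke o' := by
      simp only [Run.trace] at hk
      split at hk
      · next h => rw [h, Option.some.inj hk]
      · cases hk
    obtain rfl := h2 _ _ this
    rw [h1] at this
    cases this
    exact ⟨rfl, rfl⟩
  refine ⟨R, hex ⟨fun k o' hk => ?_, fun k k' hkk _ hk hk' => ?_⟩, h0, h1, fun k => ?_,
    hcor p hp, h2⟩
  · obtain ⟨rfl, rfl⟩ := h3 k o' hk
    change allowed (R.proc 0) _
    rwa [h0]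
  · obtain ⟨o1, ho1⟩ := Option.isSome_iff_exists.1 hk
    obtain ⟨o2, ho2⟩ := Option.isSome_iff_exists.1 hk'
    have := (h3 _ _ ho1).1
    have := (h3 _ _ ho2).1
    omega
  · rcases Nat.eq_zero_or_pos k with rfl | hk
    · rwa [h0]
    · exact (hR k hk).1

theorem IsExecution.state_of_silent {t : ℕ} {allowed : Fin n → Inv → Prop} {R : Run A}
    (h : R.IsExecution t allowed) {p : Fin n} (hp : ∀ k, R.proc k ≠ p) (k : ℕ) :
    R.state k p = A.start p := by
  induction k with
  | zero => rw [h.start]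
  | succ k ih =>
    have hs := h.step k
    unfold IsStep at hs
    split at hs
    · rw [hs, Function.update_of_ne (hp k).symm, ih]
    · obtain ⟨-, m, -, hs⟩ := hs
      rw [hs, Function.update_of_ne (hp k).symm, ih]
    · rw [hs, Function.update_of_ne (hp k).symm, ih]

end Run

/-! ### Gluing a run of the processes of `Q` after a run of the others. -/

def Action.shift (K : ℕ) : Action Inv → Action Inv
  | .invoke o => .invoke o
  | .receive s => .receive (K + s)
  | .compute => .compute

namespace Run

variable {A : Algorithm n Inv Res}

open Classical in
/-- The first `K` events of `R₁`, followed by the events of `R₂`, in which the processes of `Q`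
take steps. -/
noncomputable def append (R₁ R₂ : Run A) (K : ℕ) (Q : Set (Fin n)) : Run A where
  proc k := if k < K then R₁.proc k else R₂.proc (k - K)
  act k := if k < K then R₁.act k else (R₂.act (k - K)).shift K
  state k p := if p ∈ Q then R₂.state (k - K) p else R₁.state (min k K) p

section

variable {R₁ R₂ : Run A} {K t : ℕ} {Q : Set (Fin n)} {allowed : Fin n → Inv → Prop}

theorem append_proc (k : ℕ) : (append R₁ R₂ K Q).proc (K + k) = R₂.proc k := by
  simp [append]

theorem append_act (k : ℕ) : (append R₁ R₂ K Q).act (K + k) = (R₂.act k).shift K := by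
  simp [append]

theorem append_state {p : Fin n} (hp : p ∈ Q) (k : ℕ) :
    (append R₁ R₂ K Q).state (K + k) p = R₂.state k p := by
  simp [append, hp]

theorem append_state_of_notMem {p : Fin n} (hp : p ∉ Q) (k : ℕ) :
    (append R₁ R₂ K Q).state (K + k) p = R₁.state K p := by
  simp [append, hp]

theorem append_sent (h₂ : ∀ k, R₂.proc k ∈ Q) (k : ℕ) :
    (append R₁ R₂ K Q).sent (K + k) = R₂.sent k := by
  unfold sent
  rw [append_act, append_proc, append_state (h₂ k)]
  cases R₂.act k <;> rfl

theorem append_out (h₂ : ∀ k, R₂.proc k ∈ Q) (k : ℕ) :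
    (append R₁ R₂ K Q).trace.out (K + k) = R₂.trace.out k := by
  simp only [trace]
  rw [append_act, append_proc, append_state (h₂ k)]
  cases R₂.act k <;> rfl

theorem append_returns (h₂ : ∀ k, R₂.proc k ∈ Q) {k l : ℕ} {r : Res}
    (hr : R₂.trace.Returns k l r) :
    (append R₁ R₂ K Q).trace.Returns (K + k) (K + l) r := by
  obtain ⟨h1, h2, h3, h4, h5⟩ := hr
  refine ⟨?_, by omega, ?_, by rwa [append_out h₂], fun m hm hml hp => ?_⟩
  · simp only [trace] at h1 ⊢
    rw [append_act]
    cases ha : R₂.act k <;> simp_all [Action.shift]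
  · change (append R₁ R₂ K Q).proc (K + l) = (append R₁ R₂ K Q).proc (K + k)
    rw [append_proc, append_proc]
    exact h3
  · obtain ⟨m, rfl⟩ := Nat.exists_eq_add_of_lt (by omega : K < m)
    rw [add_assoc] at hm hml hp ⊢
    rw [append_out h₂]
    refine h5 _ (by omega) (by omega) ?_
    change (append R₁ R₂ K Q).proc _ = (append R₁ R₂ K Q).proc _ at hp
    rwa [append_proc, append_proc] at hp

/-- Up to time `K` the truncated difference `k - K` is 0, so a process of `Q` is shown in its
initial state; this is correct since it is silent in `R₁`. -/
theorem agree_append (e₁ : R₁.IsExecution t allowed) (e₂ : R₂.IsExecution t allowed)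
    (h₁ : ∀ k, R₁.proc k ∉ Q) : Agree R₁ (append R₁ R₂ K Q) K where
  proc k hk := by simp [append, hk]
  act k hk := by simp [append, hk]
  state k hk := by
    funext p
    by_cases hp : p ∈ Q
    · rw [e₁.state_of_silent fun k he => h₁ k (he ▸ hp)]
      simp [append, hp, Nat.sub_eq_zero_of_le hk, e₂.start]
    · simp [append, hp, hk]

/-- The processes of `Q` find themselves at time `K` in the initial configuration of `R₂`, and no
message from the first part is delivered in the second. -/
theorem append_isStep (e₁ : R₁.IsExecution t allowed) (e₂ : R₂.IsExecution t allowed)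
    (h₁ : ∀ k, R₁.proc k ∉ Q) (h₂ : ∀ k, R₂.proc k ∈ Q) (k : ℕ) :
    (append R₁ R₂ K Q).IsStep k := by
  by_cases hk : k < K
  · exact (agree_append e₁ e₂ h₁).isStep hk (e₁.step k)
  · obtain ⟨k, rfl⟩ := Nat.exists_eq_add_of_le (not_lt.1 hk)
    have key : ∀ x, R₂.state (k + 1) = Function.update (R₂.state k) (R₂.proc k) x →
        (append R₁ R₂ K Q).state (K + k + 1) =
          Function.update ((append R₁ R₂ K Q).state (K + k)) (R₂.proc k) x := by
      intro x hx
      funext p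
      rw [add_assoc]
      by_cases hp : p ∈ Q
      · rw [append_state hp, hx]
        by_cases hpk : p = R₂.proc k
        · subst hpk
          simp
        · rw [Function.update_of_ne hpk, Function.update_of_ne hpk, append_state hp]
      · have hpk : p ≠ R₂.proc k := fun he => hp (he ▸ h₂ k)
        rw [append_state_of_notMem hp, Function.update_of_ne hpk, append_state_of_notMem hp]
    have hs := e₂.step k
    unfold IsStep at hs ⊢
    rw [append_act, append_proc, append_state (h₂ k)]
    cases ha : R₂.act k with
    | invoke o =>
      simp only [ha, Action.shift] at hs ⊢
      exact key _ hs
    | compute =>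
      simp only [ha, Action.shift] at hs ⊢
      exact key _ hs
    | receive s =>
      simp only [ha, Action.shift] at hs ⊢
      obtain ⟨h3, m, h4, h5⟩ := hs
      refine ⟨by omega, m, by rwa [append_sent h₂], ?_⟩
      rw [append_proc]
      exact key _ h5

/-- Receptions in the first part refer to events before `K`, the shifted ones to events from `K` on.
-/
theorem append_nodup (e₁ : R₁.IsExecution t allowed) (e₂ : R₂.IsExecution t allowed)
    (s k k' : ℕ) (hk : (append R₁ R₂ K Q).act k = .receive s)
    (hk' : (append R₁ R₂ K Q).act k' = .receive s) : k = k' := by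
  have lt : ∀ {k}, R₁.act k = .receive s → s < k := by
    intro k hk
    have := e₁.step k
    unfold IsStep at this
    simp only [hk] at this
    exact this.1
  have shift : ∀ {a : Action Inv}, a.shift K = .receive s → ∃ s', s = K + s' ∧ a = .receive s' := by
    intro a ha
    cases a <;> simp only [Action.shift, reduceCtorEq, Action.receive.injEq] at ha
    exact ⟨_, ha.symm, rfl⟩
  simp only [append] at hk hk'
  split_ifs at hk hk' with h h' h'
  · exact e₁.noDuplication s k k' hk hk'
  · obtain ⟨s', rfl, -⟩ := shift hk'
    have := lt hk
    omega
  · obtain ⟨s', rfl, -⟩ := shift hk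
    have := lt hk'
    omega
  · obtain ⟨s', rfl, h1⟩ := shift hk
    obtain ⟨s'', h2, h3⟩ := shift hk'
    obtain rfl : s' = s'' := by omega
    have := e₂.noDuplication s' _ _ h1 h3
    omega

end

end Run

end CAMP

namespace CAMP

variable {n : ℕ} {V : Type}

/-! ### Specifications of registers -/

theorem Trace.Returns.unique {Inv Res : Type} {T : Trace n Inv Res} {k l l' : ℕ} {r r' : Res}
    (h : T.Returns k l r) (h' : T.Returns k l' r') : l = l' ∧ r = r' := by
  have key : ∀ {l l' : ℕ} {r r' : Res}, T.Returns k l r → T.Returns k l' r' → ¬ l < l' := by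
    intro l l' r r' h h' hl
    have := h'.2.2.2.2 l h.2.1 hl h.2.2.1
    rw [h.2.2.2.1] at this
    cases this
  obtain rfl := le_antisymm (not_lt.1 (key h' h)) (not_lt.1 (key h h'))
  exact ⟨rfl, Option.some.inj (h.2.2.2.1.symm.trans h'.2.2.2.1)⟩

/-- The value of a register is its initial value, or that of the last write. -/
theorem regValue_spec (v₀ : V) (H : History n (RegOp V) (RegRes V)) (S : ℕ → Option ℕ) (x : ℕ) :
    (regValue v₀ H S x = v₀ ∧ ∀ y < x, ∀ a v, (S y).bind H = some a → a.op ≠ .write v) ∨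
    ∃ y < x, ∃ a, (S y).bind H = some a ∧ a.op = .write (regValue v₀ H S x) ∧
      ∀ z < x, ∀ b v, (S z).bind H = some b → b.op = .write v → z ≤ y := by
  induction x with
  | zero => exact .inl ⟨rfl, by simp⟩
  | succ x ih =>
    by_cases hw : ∃ a v, (S x).bind H = some a ∧ a.op = .write v
    · obtain ⟨⟨p, o, r⟩, v, ha, rfl⟩ := hw
      refine .inr ⟨x, x.lt_succ_self, _, ha, ?_, fun z hz _ _ _ _ => Nat.le_of_lt_succ hz⟩
      simp [regValue, ha]
    · have hv : regValue v₀ H S (x + 1) = regValue v₀ H S x := by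
        rw [regValue]
        split
        · next h => exact absurd ⟨_, _, h, rfl⟩ hw
        · rfl
      rw [hv]
      rcases ih with ⟨h1, h2⟩ | ⟨y, hy, a, ha, hav, h2⟩
      · refine .inl ⟨h1, fun y hy a v ha hav => ?_⟩
        rcases Nat.lt_succ_iff_lt_or_eq.1 hy with hy | rfl
        · exact h2 y hy a v ha hav
        · exact hw ⟨a, v, ha, hav⟩
      · refine .inr ⟨y, hy.trans x.lt_succ_self, a, ha, hav, fun z hz b v hb hbv => ?_⟩
        rcases Nat.lt_succ_iff_lt_or_eq.1 hz with hz | rfl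
        · exact h2 z hz b v hb hbv
        · exact absurd ⟨b, v, hb, hbv⟩ hw

/-- No two writes are concurrent. -/
def WritesSequential (T : Trace n (RegOp V) (RegRes V)) : Prop :=
  ∀ w w' v v', T.inv w = some (.write v) → T.inv w' = some (.write v') → w < w' → T.Precedes w w'

/-- A read returns the value of the last write before it in the linearization. This write cannot
follow the read in real time. If it precedes the read, no other preceding write is later, since
sequential writes are linearized in their order. -/
theorem AtomicSpec.regular {v₀ : V} {T : Trace n (RegOp V) (RegRes V)} (h : AtomicSpec v₀ T)
    (hT : WritesSequential T) : RegularSpec v₀ T := by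
  obtain ⟨H, ⟨hH1, hH2⟩, S, ⟨hS1, hS2, hS3⟩, hL⟩ := h
  have hret : ∀ {k l r}, T.Returns k l r →
      ∃ x a, S x = some k ∧ H k = some a ∧ a.res = r ∧ T.inv k = some a.op := by
    intro k l r hr
    obtain ⟨a, ha, har⟩ := hH2 k l r hr
    obtain ⟨x, hx, -⟩ := hS2 k (by rw [ha]; rfl)
    exact ⟨x, a, hx, ha, har, (hH1 k a ha).2⟩
  refine ⟨fun k l r hr => ?_, fun k l v hk hr => ?_⟩
  · obtain ⟨x, ⟨p, o, r'⟩, hx, ha, har, hi⟩ := hret hr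
    have := hL x k _ hx ha
    rw [hi]
    obtain rfl : r' = r := har
    cases o <;> cases r' <;> simp_all
  · obtain ⟨x, ⟨p, o, r'⟩, hx, ha, har, hi⟩ := hret hr
    have hleg := hL x k _ hx ha
    obtain rfl : r' = .value v := har
    obtain rfl : o = .read := by
      rw [hk] at hi
      exact (Option.some.inj hi).symm
    have hv : v = regValue v₀ H S x := hleg
    have hbefore : ∀ {w v' l r}, T.inv w = some (.write v') → T.Returns w l r → l < k →
        ∃ y < x, ∃ b, S y = some w ∧ (S y).bind H = some b ∧ b.op = .write v' := by
      intro w v' l r hw hr hlk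
      obtain ⟨y, b, hy, hb, -, hbi⟩ := hret hr
      rw [hw] at hbi
      exact ⟨y, hS3 y x w k hy hx ⟨l, r, hr, hlk⟩, b, hy, by rw [hy]; exact hb,
        (Option.some.inj hbi).symm⟩
    rcases regValue_spec v₀ H S x with ⟨h1, h2⟩ | ⟨y, hy, b, hb, hbv, h2⟩
    · refine .inl (.inr ⟨hv.trans h1, ?_⟩)
      rintro w v' hw ⟨l', r', hr', hl'⟩
      obtain ⟨y, hy, b, -, hb, hbv⟩ := hbefore hw hr' hl'
      exact h2 y hy b v' hb hbv
    · obtain ⟨w, hw, hwb⟩ := Option.bind_eq_some_iff.1 hb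
      have hwi : T.inv w = some (.write v) := by rw [(hH1 w b hwb).2, hbv, hv]
      by_cases hp : T.Precedes w k
      · refine .inl (.inl ⟨w, hwi, hp, ?_⟩)
        rintro w' v' hw' ⟨l', r', hr', hl'⟩
        by_contra hlt
        obtain ⟨z, hz, c, hzw, hc, hcv⟩ := hbefore hw' hr' hl'
        have := hS3 y z w w' hw hzw (hT w w' v v' hwi hw' (not_le.1 hlt))
        have := h2 z hz c v' hc hcv
        omega
      · refine .inr ⟨w, hwi, hp, fun hp' => ?_⟩
        have := hS3 x y k w hx hw hp'
        omega

theorem RegularSpec.safe {v₀ : V} {T : Trace n (RegOp V) (RegRes V)} (h : RegularSpec v₀ T) :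
    SafeSpec v₀ T :=
  ⟨h.1, fun k l v hk hr hc => (h.2 k l v hk hr).resolve_right fun ⟨w, hw, hwk⟩ => hc w v hw hwk⟩

theorem AtomicSpec.registerSpec {v₀ : V} {T : Trace n (RegOp V) (RegRes V)} (h : AtomicSpec v₀ T)
    (hT : WritesSequential T) (κ : RegisterKind) : RegisterSpec κ v₀ T :=
  match κ with
  | .safe => (h.regular hT).safe
  | .regular => h.regular hT
  | .atomic => h

theorem RegisterSpec.safe {v₀ : V} {T : Trace n (RegOp V) (RegRes V)} {κ : RegisterKind}
    (h : RegisterSpec κ v₀ T) (hT : WritesSequential T) : SafeSpec v₀ T :=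
  match κ, h with
  | .safe, h => h
  | .regular, h => RegularSpec.safe h
  | .atomic, h => (AtomicSpec.regular h hT).safe

theorem Trace.ProperUse.writesSequential {T : Trace n (RegOp V) (RegRes V)} {w : Fin n}
    (h : T.ProperUse (regAllowed {w})) : WritesSequential T := fun k k' v v' hk hk' hkk =>
  h.2 k k' hkk ((h.1 k _ hk : T.proc k = w).trans (h.1 k' _ hk' : T.proc k' = w).symm)
    (by rw [hk]; rfl) (by rw [hk']; rfl)

/-! ### Registers need a majority of correct processes -/

theorem Run.trace_inv_eq_some {Inv Res : Type} {A : Algorithm n Inv Res} {R : Run A} {k : ℕ}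
    {o : Inv} : R.trace.inv k = some o ↔ R.act k = .invoke o := by
  unfold Run.trace
  cases ha : R.act k <;> simp [ha]

/-- The partition argument. Safety is demanded only of traces with sequential writes, which is all
that the runs constructed here need; this also covers atomic registers with several writers. -/
theorem two_mul_lt_of_solvable [Nontrivial V] (v₀ : V) {t : ℕ} (ht : t < n) {writers : Set (Fin n)}
    {w : Fin n} (hw : w ∈ writers) (spec : Trace n (RegOp V) (RegRes V) → Prop)
    (hspec : ∀ T, WritesSequential T → spec T → SafeSpec v₀ T)
    (hsol : Solvable n t (regAllowed writers) spec) : 2 * t < n := by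
  by_contra hcon
  obtain ⟨A, hA⟩ := hsol
  obtain ⟨v, hv⟩ := exists_ne v₀
  -- `P` contains the writer and has `t` elements, which is possible because `t < n ≤ 2 * t` forces
  -- `1 ≤ t`. Its complement is non-empty and has at most `t` elements, so either group may crash as
  -- a whole.
  obtain ⟨P, hwP, -, hP⟩ := Finset.exists_subsuperset_card_eq (Finset.subset_univ {w})
    (n := t) (by rw [Finset.card_singleton]; omega) (by rw [Finset.card_fin]; exact ht.le)
  replace hwP : w ∈ P := hwP (Finset.mem_singleton_self w)
  let Q : Set (Fin n) := (P : Set (Fin n))ᶜ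
  have hPc : ((P : Set (Fin n))ᶜ).ncard ≤ t := by
    rw [Set.ncard_compl, Set.ncard_coe_finset, hP, Nat.card_eq_fintype_card, Fintype.card_fin]
    omega
  have hQc : Qᶜ.ncard ≤ t := by rw [compl_compl, Set.ncard_coe_finset, hP]
  obtain ⟨q, hq⟩ : ∃ q, q ∈ Q := by
    by_contra hno
    have : P = Finset.univ := by
      ext x
      simpa using not_not.1 fun hx => hno ⟨x, by simpa [Q] using hx⟩
    rw [this, Finset.card_fin] at hP
    omega
  obtain ⟨R₁, e₁, hp₁, ha₁, hC₁, hc₁, hi₁⟩ := Run.exists_solo A (t := t)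
    (allowed := regAllowed writers) P hPc (p := w) hwP (o := .write v) hw
  obtain ⟨R₂, e₂, hp₂, ha₂, hC₂, hc₂, hi₂⟩ := Run.exists_solo A (t := t)
    (allowed := regAllowed writers) Q hQc (p := q) hq (o := .read) trivial
  have h₁ : ∀ k, R₁.proc k ∉ Q := fun k hk => hk (hC₁ k)
  obtain ⟨l₁, r₁, hr₁⟩ := (hA R₁ e₁).1 0 (by rw [Run.trace_inv_eq_some.2 ha₁]; rfl)
    (show R₁.trace.Correct (R₁.proc 0) by rwa [hp₁])
  obtain ⟨l₂, r₂, hr₂⟩ := (hA R₂ e₂).1 0 (by rw [Run.trace_inv_eq_some.2 ha₂]; rfl)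
    (show R₂.trace.Correct (R₂.proc 0) by rwa [hp₂])
  have hno₂ : ∀ k v', R₂.trace.inv k ≠ some (.write v') := by
    intro k v' hk
    rw [Run.trace_inv_eq_some] at hk
    obtain rfl := hi₂ k _ hk
    rw [ha₂] at hk
    cases hk
  have hs₂ := hspec _ (fun w w' v v' hw => absurd hw (hno₂ w v)) (hA R₂ e₂).2
  obtain ⟨u, rfl⟩ := (hs₂.1 0 l₂ r₂ hr₂).1 (Run.trace_inv_eq_some.2 ha₂)
  -- In `R₂` nothing is written, so the read returns the initial value.
  obtain rfl : u = v₀ := by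
    rcases hs₂.2 0 l₂ u (Run.trace_inv_eq_some.2 ha₂) hr₂
      (fun w v' hw => absurd hw (hno₂ w v')) with ⟨w', hw', -⟩ | h
    · exact absurd hw' (hno₂ w' _)
    · exact h.1
  -- After both operations have returned, all processes go on and the delayed messages are
  -- delivered, so the glued run is an execution without crashes.
  obtain ⟨R, hag, hR, -, hex⟩ := Run.exists_extension (t := t) (allowed := regAllowed writers)
    (Run.append R₁ R₂ (l₁ + 1) Q) (l₁ + 1 + (l₂ + 1))
    (by rw [← (Run.agree_append e₁ e₂ h₁).state 0 (Nat.zero_le _), e₁.start])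
    (fun k _ => Run.append_isStep e₁ e₂ h₁ hC₂ k)
    (fun s k k' _ _ => Run.append_nodup e₁ e₂ s k k') Set.univ ⟨w, trivial⟩ (by simp)
  have hag₁ := (Run.agree_append e₁ e₂ h₁).trans (hag.mono (Nat.le_add_right (l₁ + 1) _))
  have hinv : ∀ k o, R.trace.inv k = some o →
      k = 0 ∧ o = .write v ∨ k = l₁ + 1 ∧ o = .read := by
    intro k o hk
    by_cases hk₁ : k < l₁ + 1
    · rw [← hag₁.inv hk₁, Run.trace_inv_eq_some] at hk
      obtain rfl := hi₁ k _ hk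
      rw [ha₁] at hk
      cases hk
      exact .inl ⟨rfl, rfl⟩
    · rw [Run.trace_inv_eq_some] at hk
      by_cases hk₂ : k < l₁ + 1 + (l₂ + 1)
      · obtain ⟨k, rfl⟩ := Nat.exists_eq_add_of_le (not_lt.1 hk₁)
        rw [← hag.act _ hk₂, Run.append_act] at hk
        have : R₂.act k = .invoke o := by
          cases ha : R₂.act k <;> rw [ha] at hk <;> cases hk
          rfl
        obtain rfl := hi₂ k _ this
        rw [ha₂] at this
        cases this
        exact .inr ⟨rfl, rfl⟩
      · exact absurd hk ((hR k (not_lt.1 hk₂)).2 o)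
  have hret₁ : R.trace.Returns 0 l₁ r₁ := hag₁.returns l₁.lt_succ_self hr₁
  have hret₂ : R.trace.Returns (l₁ + 1) (l₁ + 1 + l₂) (.value u) :=
    hag.returns (by omega) (Run.append_returns hC₂ hr₂)
  have hproc₁ : R.trace.proc 0 = w := (hag₁.proc 0 (Nat.succ_pos _)).symm.trans hp₁
  have hprec : R.trace.Precedes 0 (l₁ + 1) := ⟨l₁, r₁, hret₁, l₁.lt_succ_self⟩
  have hinv₁ : R.trace.inv 0 = some (.write v) := by
    obtain ⟨o, ho⟩ := Option.isSome_iff_exists.1 hret₁.1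
    rcases hinv 0 o ho with ⟨-, rfl⟩ | ⟨h0, -⟩
    · exact ho
    · omega
  have hinv₂ : R.trace.inv (l₁ + 1) = some .read := by
    obtain ⟨o, ho⟩ := Option.isSome_iff_exists.1 hret₂.1
    rcases hinv _ o ho with ⟨h0, -⟩ | ⟨-, rfl⟩
    · omega
    · exact ho
  have hwrite : ∀ k v', R.trace.inv k = some (.write v') → k = 0 := by
    intro k v' hk
    rcases hinv k _ hk with ⟨h0, -⟩ | ⟨-, h0⟩
    · exact h0
    · cases h0
  have hexec := hex ⟨fun k o hk => ?_, fun k k' hkk _ hk hk' => ?_⟩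
  · have hsafe := hspec _ (fun k k' v v' hk hk' hkk => by
      have := hwrite k v hk
      have := hwrite k' v' hk'
      omega) (hA R hexec).2
    rcases hsafe.2 _ _ u hinv₂ hret₂ (fun k v' hk hc => by
      obtain rfl := hwrite k v' hk
      exact hc.1 hprec) with ⟨k, hk, -⟩ | ⟨-, hno⟩
    · rcases hinv k _ hk with ⟨-, h0⟩ | ⟨-, h0⟩
      · exact hv (RegOp.write.inj h0).symm
      · cases h0
    · exact hno 0 v hinv₁ hprec
  · rcases hinv k o hk with ⟨rfl, rfl⟩ | ⟨-, rfl⟩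
    · exact hproc₁ ▸ hw
    · trivial
  · obtain ⟨o, ho⟩ := Option.isSome_iff_exists.1 hk
    obtain ⟨o', ho'⟩ := Option.isSome_iff_exists.1 hk'
    rcases hinv k o ho with ⟨rfl, -⟩ | ⟨rfl, -⟩ <;> rcases hinv k' o' ho' with ⟨rfl, -⟩ | ⟨rfl, -⟩
    · omega
    · exact hprec
    · omega
    · omega

end CAMP

namespace CAMP

/-! ### Registers with a majority of correct processes -/

/-- What a process is doing: looking for the present value, or propagating its value before it
returns `r`. -/
inductive RegMode (V : Type) where
  | idle
  | query (o : RegOp V)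
  | prop (r : RegRes V)

/-- The local state: the tag and the value of the latest known write, the number of phases
started, the latest known phase of each process, the processes known to know of the present phase,
and the mode. -/
structure RegState (n : ℕ) (V : Type) where
  tag : ℕ
  val : V
  ph : ℕ
  known : Fin n → ℕ
  acks : Finset (Fin n)
  mode : RegMode V

/-- The end of a phase, when a majority has acknowledged it. -/
def regOut {n : ℕ} {V : Type} (p : Fin n) (s : RegState n V) : RegState n V × Option (RegRes V) :=
  if n < 2 * s.acks.card then
    match s.mode with
    | .idle => (s, none)
    | .query .read =>
      ({ s with ph := s.ph + 1, acks := ∅, mode := .prop (.value s.val) }, none)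
    | .query (.write v) =>
      ({ s with
          -- The quotient by `n` is a timestamp and the remainder identifies the writer, so the
          -- order of tags is lexicographic.
          tag := (s.tag / n + 1) * n + p, val := v, ph := s.ph + 1, acks := ∅, mode := .prop .ack },
        none)
    | .prop r => ({ s with mode := .idle }, some r)
  else (s, none)

/-- There are no separate requests and replies: a gossiped state acknowledges the present phase of
`p` if its sender already knew that phase. -/
def regReceive {n : ℕ} {V : Type} (p : Fin n) (s : RegState n V) (q : Fin n) (m : RegState n V) :
    RegState n V :=
  { s with
    tag := max s.tag m.tag
    val := if s.tag < m.tag then m.val else s.val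
    known := Function.update s.known q (max (s.known q) m.ph)
    acks := if s.ph ≤ m.known p then insert q s.acks else s.acks }

/-- The algorithm of Attiya, Bar-Noy and Dolev, for several writers. -/
def regGossip (n : ℕ) {V : Type} (v₀ : V) : Gossip n (RegOp V) (RegRes V) where
  St := RegState n V
  start _ := ⟨0, v₀, 0, fun _ => 0, ∅, .idle⟩
  inv _ s o := { s with ph := s.ph + 1, acks := ∅, mode := .query o }
  rcv := regReceive
  out := regOut

namespace Reg

open Gossip

variable {n t : ℕ} {V : Type} {v₀ : V}

/-- The local state of process `p` before event `k`. -/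
def state (R : Run (regGossip n v₀).alg) (k : ℕ) (p : Fin n) : RegState n V := st R k p

/-- A majority has acknowledged the present phase of `p`. -/
def Majority (R : Run (regGossip n v₀).alg) (k : ℕ) (p : Fin n) : Prop :=
  n < 2 * (state R k p).acks.card

theorem Majority.lt {R : Run (regGossip n v₀).alg} {k : ℕ} {p : Fin n} (h : Majority R k p) :
    n < 2 * (state R k p).acks.card := h

/-- The operation `o`, invoked in event `k`, takes effect in event `m`. -/
structure Commit (R : Run (regGossip n v₀).alg) (k m : ℕ) (o : RegOp V) : Prop where
  inv : R.act k = .invoke o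
  lt : k < m
  proc : R.proc m = R.proc k
  act : R.act m = .compute
  mode : (state R m (R.proc k)).mode = .query o
  maj : Majority R m (R.proc k)
  ph : (state R m (R.proc k)).ph = (state R (k + 1) (R.proc k)).ph

/-- The result of the operation `o` that takes effect in event `m`. -/
def result (R : Run (regGossip n v₀).alg) (m : ℕ) : RegOp V → RegRes V
  | .read => .value (state R (m + 1) (R.proc m)).val
  | .write _ => .ack

/-- How local states evolve. -/
def Le (a b : RegState n V) : Prop :=
  a.tag ≤ b.tag ∧ (∀ q, a.known q ≤ b.known q) ∧ (a.ph < b.ph ∨ a.ph = b.ph ∧ a.acks ⊆ b.acks)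

theorem lt_newTag (τ : ℕ) (p : Fin n) : τ < (τ / n + 1) * n + p := by
  have h1 := Nat.div_add_mod τ n
  have h2 := Nat.mod_lt τ p.pos
  rw [add_mul, mul_comm (τ / n)]
  omega

variable {R : Run (regGossip n v₀).alg}

section

variable {allowed : Fin n → RegOp V → Prop} (h : R.IsExecution t allowed)
include h

theorem le (p : Fin n) {j k : ℕ} (hjk : j ≤ k) : Le (state R j p) (state R k p) := by
  refine st_mono h (fun a b : RegState n V => Le a b) (fun a => ?_) (fun a b c hab hbc => ?_)
    (fun p s o => ?_) (fun p s q m => ?_) (fun p s => ?_) p hjk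
  · exact ⟨le_rfl, fun _ => le_rfl, .inr ⟨rfl, Finset.Subset.refl _⟩⟩
  · refine ⟨hab.1.trans hbc.1, fun q => (hab.2.1 q).trans (hbc.2.1 q), ?_⟩
    rcases hab.2.2 with h1 | ⟨h1, h2⟩ <;> rcases hbc.2.2 with h3 | ⟨h3, h4⟩
    · exact .inl (h1.trans h3)
    · exact .inl (h1.trans_eq h3)
    · exact .inl (h1.trans_lt h3)
    · exact .inr ⟨h1.trans h3, h2.trans h4⟩
  · exact ⟨le_rfl, fun _ => le_rfl, .inl (Nat.lt_succ_self _)⟩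
  · refine ⟨le_max_left _ _, fun q' => ?_, .inr ⟨rfl, ?_⟩⟩
    · change s.known q' ≤ Function.update s.known q (max (s.known q) m.ph) q'
      by_cases hq : q' = q
      · subst hq
        rw [Function.update_self]
        exact le_max_left _ _
      · rw [Function.update_of_ne hq]
    · change s.acks ⊆ if s.ph ≤ m.known p then insert q s.acks else s.acks
      split_ifs
      · exact Finset.subset_insert _ _
      · exact Finset.Subset.refl _
  · change Le s (regOut p s).1
    unfold regOut
    split_ifs
    · split
      · exact ⟨le_rfl, fun _ => le_rfl, .inr ⟨rfl, Finset.Subset.refl _⟩⟩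
      · exact ⟨le_rfl, fun _ => le_rfl, .inl (Nat.lt_succ_self _)⟩
      · exact ⟨(lt_newTag _ _).le, fun _ => le_rfl, .inl (Nat.lt_succ_self _)⟩
      · exact ⟨le_rfl, fun _ => le_rfl, .inr ⟨rfl, Finset.Subset.refl _⟩⟩
    · exact ⟨le_rfl, fun _ => le_rfl, .inr ⟨rfl, Finset.Subset.refl _⟩⟩

theorem tag_mono (p : Fin n) {j k : ℕ} (hjk : j ≤ k) : (state R j p).tag ≤ (state R k p).tag :=
  (le h p hjk).1

theorem ph_mono (p : Fin n) {j k : ℕ} (hjk : j ≤ k) : (state R j p).ph ≤ (state R k p).ph := by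
  rcases (le h p hjk).2.2 with h1 | h1
  · exact h1.le
  · exact h1.1.le

theorem lt_of_ph_lt {p : Fin n} {j k : ℕ} (hjk : (state R j p).ph < (state R k p).ph) : j < k :=
  lt_of_not_ge fun hkj => hjk.not_ge (ph_mono h p hkj)

theorem state_invoke {k : ℕ} {o : RegOp V} (ha : R.act k = .invoke o) :
    state R (k + 1) (R.proc k) =
      { state R k (R.proc k) with
        ph := (state R k (R.proc k)).ph + 1, acks := ∅, mode := .query o } :=
  (Gossip.state_invoke (h.step k) ha).1

theorem state_receive {k s : ℕ} (ha : R.act k = .receive s) :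
    state R (k + 1) (R.proc k) =
      regReceive (R.proc k) (state R k (R.proc k)) (R.proc s) (state R s (R.proc s)) :=
  (Gossip.state_receive (h.step k) ha).2.1

theorem state_compute {k : ℕ} (ha : R.act k = .compute) :
    state R (k + 1) (R.proc k) = (regOut (R.proc k) (state R k (R.proc k))).1 :=
  (Gossip.state_compute (h.step k) ha).1

/-- A process that knows a phase of `p` has at least the tag that `p` had in this phase. -/
theorem exists_of_known {k : ℕ} {p q : Fin n} {c : ℕ} (hc : 0 < c)
    (hk : c ≤ (state R k q).known p) :
    ∃ s < k, c ≤ (state R s p).ph ∧ (state R s p).tag ≤ (state R k q).tag := by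
  refine invariant h (fun k q (x : RegState n V) => ∀ p c, 0 < c → c ≤ x.known p →
    ∃ s < k, c ≤ (state R s p).ph ∧ (state R s p).tag ≤ x.tag) ?_ ?_ ?_ ?_ ?_ k q p c hc hk
  · intro k q x hx p c hc hk
    obtain ⟨s, hs, h1⟩ := hx p c hc hk
    exact ⟨s, hs.trans k.lt_succ_self, h1⟩
  · intro q p c hc hk
    exact absurd hk (not_le.2 hc)
  · intro k o _ hx p c hc hk
    obtain ⟨s, hs, h1⟩ := hx p c hc hk
    exact ⟨s, hs.trans k.lt_succ_self, h1⟩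
  · intro k s _ hs hx _ p c hc hk
    change c ≤ Function.update (state R k (R.proc k)).known (R.proc s) _ p at hk
    by_cases hp : p = R.proc s
    · subst hp
      rw [Function.update_self, le_max_iff] at hk
      rcases hk with hk | hk
      · obtain ⟨s', hs', h1, h2⟩ := hx _ c hc hk
        exact ⟨s', hs'.trans k.lt_succ_self, h1, h2.trans (le_max_left _ _)⟩
      · exact ⟨s, hs.trans k.lt_succ_self, hk, le_max_right _ _⟩
    · rw [Function.update_of_ne hp] at hk
      obtain ⟨s', hs', h1, h2⟩ := hx _ c hc hk
      exact ⟨s', hs'.trans k.lt_succ_self, h1, h2.trans (le_max_left _ _)⟩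
  · intro k ha hx p c hc hk
    have hk' : c ≤ (state R k (R.proc k)).known p := by
      refine hk.trans_eq ?_
      change (regOut _ (state R k (R.proc k))).1.known p = _
      unfold regOut
      split_ifs
      · split <;> rfl
      · rfl
    obtain ⟨s, hs, h1, h2⟩ := hx p c hc hk'
    refine ⟨s, hs.trans k.lt_succ_self, h1, h2.trans ?_⟩
    have := tag_mono h (R.proc k) k.le_succ
    rwa [Nat.succ_eq_add_one, state_compute h ha] at this

/-- A process that acknowledged the present phase of `p` knew of it, and `p` has at least the tag
that this process had then. -/
theorem exists_of_mem_acks {k : ℕ} {p q : Fin n} (hq : q ∈ (state R k p).acks) :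
    ∃ m < k, (state R k p).ph ≤ (state R m q).known p ∧ (state R m q).tag ≤ (state R k p).tag := by
  refine invariant h (fun k p (x : RegState n V) => ∀ q ∈ x.acks,
    ∃ m < k, x.ph ≤ (state R m q).known p ∧ (state R m q).tag ≤ x.tag) ?_ ?_ ?_ ?_ ?_ k p q hq
  · intro k p x hx q hq
    obtain ⟨m, hm, h1⟩ := hx q hq
    exact ⟨m, hm.trans k.lt_succ_self, h1⟩
  · intro p q hq
    exact absurd hq (Finset.notMem_empty _)
  · intro k o _ _ q hq
    exact absurd hq (Finset.notMem_empty _)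
  · intro k s _ hs hx _ q hq
    change q ∈ if (state R k (R.proc k)).ph ≤ (state R s (R.proc s)).known (R.proc k) then
      insert (R.proc s) (state R k (R.proc k)).acks else (state R k (R.proc k)).acks at hq
    have old : q ∈ (state R k (R.proc k)).acks → ∃ m < k + 1,
        (state R k (R.proc k)).ph ≤ (state R m q).known (R.proc k) ∧ (state R m q).tag ≤
          max (state R k (R.proc k)).tag (state R s (R.proc s)).tag := by
      intro hq
      obtain ⟨m, hm, h1, h2⟩ := hx q hq
      exact ⟨m, hm.trans k.lt_succ_self, h1, h2.trans (le_max_left _ _)⟩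
    split_ifs at hq with hph
    · rcases Finset.mem_insert.1 hq with rfl | hq
      · exact ⟨s, hs.trans k.lt_succ_self, hph, le_max_right _ _⟩
      · exact old hq
    · exact old hq
  · intro k ha hx q hq
    change q ∈ (regOut (R.proc k) (state R k (R.proc k))).1.acks at hq
    have same : (regOut (R.proc k) (state R k (R.proc k))).1.acks = ∅ ∨
        (regOut (R.proc k) (state R k (R.proc k))).1.acks = (state R k (R.proc k)).acks ∧
        (regOut (R.proc k) (state R k (R.proc k))).1.ph = (state R k (R.proc k)).ph ∧
        (regOut (R.proc k) (state R k (R.proc k))).1.tag = (state R k (R.proc k)).tag := by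
      unfold regOut
      split_ifs
      · split <;> simp
      · simp
    rcases same with he | ⟨he, hph, htag⟩
    · rw [he] at hq
      exact absurd hq (Finset.notMem_empty _)
    · rw [he] at hq
      obtain ⟨m, hm, h1, h2⟩ := hx q hq
      exact ⟨m, hm.trans k.lt_succ_self, hph.trans_le h1, h2.trans_eq htag.symm⟩

/-- A tag that a process has at the beginning of a phase that has been acknowledged by a majority
is known at the end of all phases that start later. -/
theorem tag_le_of_majority {p p' : Fin n} {s k s' k' : ℕ} (hk : Majority R k p)
    (hk' : Majority R k' p') (hs : (state R s p).ph < (state R k p).ph)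
    (hs' : (state R s' p').ph < (state R k' p').ph) (hks : k ≤ s') :
    (state R (s + 1) p).tag ≤ (state R k' p').tag := by
  -- Two majorities intersect.
  obtain ⟨q, hq, hq'⟩ : ∃ q, q ∈ (state R k p).acks ∧ q ∈ (state R k' p').acks := by
    by_contra hno
    have hd : Disjoint (state R k p).acks (state R k' p').acks :=
      Finset.disjoint_left.2 fun q h1 h2 => hno ⟨q, h1, h2⟩
    have := Finset.card_le_univ ((state R k p).acks ∪ (state R k' p').acks)
    rw [Finset.card_union_of_disjoint hd, Fintype.card_fin] at this
    unfold Majority at hk hk'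
    omega
  obtain ⟨m₁, hm₁, h1, -⟩ := exists_of_mem_acks h hq
  obtain ⟨m₂, hm₂, h2, h3⟩ := exists_of_mem_acks h hq'
  obtain ⟨s₁, -, h4, h5⟩ := exists_of_known h ((Nat.zero_le _).trans_lt hs) h1
  obtain ⟨s₂, hs₂, h6, -⟩ := exists_of_known h ((Nat.zero_le _).trans_lt hs') h2
  -- The common member `q` heard of the first phase at a state `s₁` of `p` later than `s`, hence
  -- with at least the tag at `s + 1`. It acknowledged the second phase only after `s'`, so after
  -- `m₁`, and passed this tag on to `p'`.
  have h7 : s < s₁ := lt_of_ph_lt h (hs.trans_le h4)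
  have h8 : s' < s₂ := lt_of_ph_lt h (hs'.trans_le h6)
  calc (state R (s + 1) p).tag ≤ (state R s₁ p).tag := tag_mono h p h7
    _ ≤ (state R m₁ q).tag := h5
    _ ≤ (state R m₂ q).tag := tag_mono h q (by omega)
    _ ≤ (state R k' p').tag := h3

/-- If the phase does not change any more, each correct process hears of it and later has its state
received by `p`. Acknowledgements persist within a phase, and more than half of the processes are
correct. -/
theorem exists_majority (ht : 2 * t < n) {p : Fin n} (hp : R.trace.Correct p) {j : ℕ}
    (hj : ∀ j', j ≤ j' → (state R j' p).ph = (state R j p).ph) :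
    ∃ k, j ≤ k ∧ R.proc k = p ∧ R.act k = .compute ∧ Majority R k p := by
  have hq : ∀ q, ∃ k, j ≤ k ∧ (R.trace.Correct q → q ∈ (state R k p).acks) := by
    intro q
    by_cases hq : R.trace.Correct q
    · obtain ⟨m, m', hm, hmp, rfl, hm'⟩ := exists_receive h hp hq j
      obtain ⟨m₂, m₂', hm₂, hmp₂, hmp₂', hm₂'⟩ := exists_receive h hq hp (max j (m' + 1))
      have h1 : (state R j p).ph ≤ (state R m₂ (R.proc m')).known p := by
        refine le_trans ?_ ((le h (R.proc m') ((le_max_right _ _).trans hm₂)).2.1 p)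
        rw [state_receive h hm', hmp]
        refine (hj m hm).symm.trans_le ?_
        simp only [regReceive, Function.update_self]
        exact le_max_right _ _
      have h2 : m₂ < m₂' := (Gossip.state_receive (h.step m₂') hm₂').1
      have h3 : j ≤ m₂' := ((le_max_left _ _).trans hm₂).trans h2.le
      refine ⟨m₂' + 1, h3.trans (Nat.le_succ _), fun _ => ?_⟩
      subst hmp₂'
      rw [state_receive h hm₂', hmp₂]
      simp only [regReceive]
      rw [if_pos (by rw [hj _ h3]; exact h1)]
      exact Finset.mem_insert_self _ _
    · exact ⟨j, le_rfl, fun h => absurd h hq⟩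
  choose f hf hf' using hq
  obtain ⟨k, hk, hkp, ha⟩ := h.progress p hp (max j (Finset.univ.sup f))
  have hjk := (le_max_left _ _).trans hk
  refine ⟨k, hjk, hkp, ha, ?_⟩
  have hsub : {q | R.trace.Correct q} ⊆ ((state R k p).acks : Set (Fin n)) := by
    intro q hq
    have hqk : f q ≤ k :=
      (Finset.le_sup (f := f) (Finset.mem_univ q)).trans ((le_max_right _ _).trans hk)
    rcases (le h p hqk).2.2 with h1 | h1
    · rw [hj _ hjk, hj _ (hf q)] at h1
      exact absurd h1 (lt_irrefl _)
    · exact h1.2 (hf' q hq)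
  have h1 := Set.ncard_le_ncard hsub (Set.toFinite _)
  have h2 := h.crashes
  have h3 : {q | R.trace.Correct q} = {q | R.trace.Faulty q}ᶜ := rfl
  rw [h3, Set.ncard_compl, Set.ncard_coe_finset, Nat.card_eq_fintype_card, Fintype.card_fin] at h1
  unfold Majority
  omega

theorem Commit.ph_succ {k m : ℕ} {o : RegOp V} (hm : Commit R k m o) :
    (state R (m + 1) (R.proc k)).ph = (state R m (R.proc k)).ph + 1 := by
  have h1 := state_compute h hm.act
  have h2 := hm.maj
  have h3 := hm.mode
  rw [hm.proc] at h1
  rw [h1, regOut, if_pos h2.lt, h3]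
  cases o <;> rfl

theorem Commit.mode_succ {k m : ℕ} {o : RegOp V} (hm : Commit R k m o) :
    (state R (m + 1) (R.proc k)).mode = .prop (result R m o) := by
  have h1 := state_compute h hm.act
  have h2 := hm.maj
  have h3 := hm.mode
  rw [hm.proc] at h1
  cases o with
  | read =>
    rw [result, hm.proc, h1, regOut, if_pos h2.lt, h3]
  | write v =>
    rw [result, h1, regOut, if_pos h2.lt, h3]

theorem Commit.tag_write {k m : ℕ} {v : V} (hm : Commit R k m (.write v)) :
    (state R (m + 1) (R.proc k)).tag = ((state R m (R.proc k)).tag / n + 1) * n + R.proc k ∧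
      (state R (m + 1) (R.proc k)).val = v := by
  have h1 := state_compute h hm.act
  have h2 := hm.maj
  have h3 := hm.mode
  rw [hm.proc] at h1
  rw [h1, regOut, if_pos h2.lt, h3]
  exact ⟨rfl, rfl⟩

/-- An operation commits in the phase opened by its invocation, and committing closes this phase. -/
theorem Commit.unique {k m m' : ℕ} {o o' : RegOp V} (hm : Commit R k m o)
    (hm' : Commit R k m' o') : m = m' ∧ o = o' := by
  have key : ∀ {m m' o o'}, Commit R k m o → Commit R k m' o' → ¬ m < m' := by
    intro m m' o o' hm hm' hlt
    have h1 := ph_mono h (R.proc k) (Nat.succ_le_of_lt hlt)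
    rw [Nat.succ_eq_add_one, Commit.ph_succ h hm, hm.ph, hm'.ph] at h1
    omega
  refine ⟨le_antisymm (not_lt.1 (key hm' hm)) (not_lt.1 (key hm hm')), ?_⟩
  have := hm.inv
  rw [hm'.inv] at this
  cases this
  rfl

theorem Commit.inv_unique {k k' m : ℕ} {o o' : RegOp V} (hm : Commit R k m o)
    (hm' : Commit R k' m o') : k = k' := by
  have key : ∀ {k k' o o'}, Commit R k m o → Commit R k' m o' → ¬ k < k' := by
    intro k k' o o' hm hm' hlt
    have h1 := ph_mono h (R.proc k) (Nat.succ_le_of_lt hlt)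
    have h2 := hm'.ph
    rw [state_invoke h hm'.inv, ← hm'.proc, hm.proc] at h2
    rw [Nat.succ_eq_add_one, ← hm.ph, h2] at h1
    simp only at h1
    omega
  exact le_antisymm (not_lt.1 (key hm' hm)) (not_lt.1 (key hm hm'))

theorem properUse {k : ℕ} {o : RegOp V} (ho : R.act k = .invoke o)
    (j : ℕ) (hkj : k < j) (hp : R.proc j = R.proc k) (hj : (R.trace.inv j).isSome) :
    R.trace.Precedes k j :=
  h.properUse.2 k j hkj hp.symm (by rw [trace_inv.2 ho]; rfl) hj

/-- An operation that has not returned is in its query phase, or has committed and is in its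
propagation phase. -/
theorem pending {k j : ℕ} {o : RegOp V} (ho : R.act k = .invoke o) (hkj : k < j)
    (hout : ∀ m, k < m → m < j → R.proc m = R.proc k → R.trace.out m = none) :
    (state R j (R.proc k)).mode = .query o ∧
        (state R j (R.proc k)).ph = (state R (k + 1) (R.proc k)).ph ∨
      ∃ m < j, Commit R k m o ∧ (state R j (R.proc k)).mode = .prop (result R m o) ∧
        (state R j (R.proc k)).ph = (state R (m + 1) (R.proc k)).ph := by
  induction hkj with
  | refl => exact .inl ⟨by rw [Nat.succ_eq_add_one, state_invoke h ho], rfl⟩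
  | @step j hkj ih =>
    simp only [Nat.succ_eq_add_one] at hkj hout ⊢
    have ih' := ih fun m hm hmj => hout m hm (hmj.trans j.lt_succ_self)
    have same : (state R (j + 1) (R.proc k)).mode = (state R j (R.proc k)).mode →
        (state R (j + 1) (R.proc k)).ph = (state R j (R.proc k)).ph →
        (state R (j + 1) (R.proc k)).mode = .query o ∧
          (state R (j + 1) (R.proc k)).ph = (state R (k + 1) (R.proc k)).ph ∨
        ∃ m < j + 1, Commit R k m o ∧ (state R (j + 1) (R.proc k)).mode = .prop (result R m o) ∧
          (state R (j + 1) (R.proc k)).ph = (state R (m + 1) (R.proc k)).ph := fun h1 h2 =>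
      ih'.imp (fun h3 => ⟨h1.trans h3.1, h2.trans h3.2⟩)
        fun ⟨m, hm, h3, h4, h5⟩ => ⟨m, hm.trans j.lt_succ_self, h3, h1.trans h4, h2.trans h5⟩
    by_cases hp : R.proc j = R.proc k
    · cases ha : R.act j with
      | invoke o' =>
        obtain ⟨l, r, hr, hl⟩ := properUse h ho j hkj hp (by rw [trace_inv.2 ha]; rfl)
        have := hout l hr.2.1 (hl.trans j.lt_succ_self) hr.2.2.1
        rw [hr.2.2.2.1] at this
        cases this
      | receive s =>
        have := state_receive h ha
        rw [hp] at this
        exact same (by rw [this]; rfl) (by rw [this]; rfl)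
      | compute =>
        have hst := state_compute h ha
        rw [hp] at hst
        by_cases hmaj : Majority R j (R.proc k)
        · rcases ih' with ⟨h1, h2⟩ | ⟨m, hm, h1, h2, h3⟩
          · have hc : Commit R k j o := ⟨ho, hkj, hp, ha, h1, hmaj, h2⟩
            exact .inr ⟨j, j.lt_succ_self, hc, Commit.mode_succ h hc, rfl⟩
          · have hno := hout j hkj j.lt_succ_self hp
            have : R.trace.out j = some (result R m o) := by
              refine trace_out.2 ⟨ha, ?_⟩
              change (regOut _ (state R j _)).2 = _
              rw [hp, regOut, if_pos hmaj.lt, h2]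
            rw [hno] at this
            cases this
        · rw [regOut, if_neg (show ¬ n < 2 * (state R j (R.proc k)).acks.card from hmaj)] at hst
          exact same (by rw [hst]) (by rw [hst])
    · have : state R (j + 1) (R.proc k) = state R j (R.proc k) :=
        st_of_ne (h.step j) (Ne.symm hp)
      exact same (by rw [this]) (by rw [this])

omit h in
theorem act_of_inv {k : ℕ} (hk : (R.trace.inv k).isSome) : ∃ o, R.act k = .invoke o := by
  obtain ⟨o, ho⟩ := Option.isSome_iff_exists.1 hk
  exact ⟨o, trace_inv.1 ho⟩

theorem returns_spec {k l : ℕ} {r : RegRes V} (hr : R.trace.Returns k l r) :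
    ∃ m o, m < l ∧ Commit R k m o ∧ result R m o = r ∧ Majority R l (R.proc k) ∧
      (state R l (R.proc k)).ph = (state R (m + 1) (R.proc k)).ph := by
  obtain ⟨o, ho⟩ := act_of_inv hr.1
  obtain ⟨-, hkl, hp, hout, hno⟩ := hr
  obtain ⟨ha, hout⟩ := trace_out.1 hout
  change R.proc l = R.proc k at hp
  change (regOut (R.proc l) (state R l (R.proc l))).2 = some r at hout
  rw [hp, regOut] at hout
  split_ifs at hout with hmaj
  rcases pending h ho hkl hno with ⟨h1, -⟩ | ⟨m, hm, h1, h2, h3⟩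
  · rw [h1] at hout
    cases o <;> cases hout
  · rw [h2] at hout
    exact ⟨m, o, hm, h1, Option.some.inj hout, hmaj, h3⟩

/-- A pending operation opens at most one further phase, so the phase number would become constant.
The next majority would then end the phase: in a query it raises the phase number, in a propagation
it yields an output. -/
theorem terminates (ht : 2 * t < n) : R.trace.Terminates := by
  classical
  intro k hk hc
  replace hc : R.trace.Correct (R.proc k) := hc
  obtain ⟨o, ho⟩ := act_of_inv hk
  have hex : ∃ m, k < m ∧ R.trace.proc m = R.trace.proc k ∧ (R.trace.out m).isSome := by
    by_contra hno
    have hout : ∀ m, k < m → R.proc m = R.proc k → R.trace.out m = none := by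
      intro m hm hp
      by_contra hne
      exact hno ⟨m, hm, hp, Option.isSome_iff_ne_none.2 hne⟩
    have hpend := fun j (hkj : k < j) =>
      pending h ho hkj fun m hm _ => hout m hm
    have hle : ∀ j, k < j →
        (state R j (R.proc k)).ph ≤ (state R (k + 1) (R.proc k)).ph + 1 := by
      intro j hkj
      rcases hpend j hkj with ⟨-, h1⟩ | ⟨m, -, h1, -, h2⟩
      · omega
      · rw [h2, Commit.ph_succ h h1, h1.ph]
    obtain ⟨j, hkj, hj⟩ : ∃ j, k < j ∧
        ∀ j', j ≤ j' → (state R j' (R.proc k)).ph = (state R j (R.proc k)).ph := by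
      by_cases hlast : ∃ j, k < j ∧
          (state R j (R.proc k)).ph = (state R (k + 1) (R.proc k)).ph + 1
      · obtain ⟨j, hkj, hj⟩ := hlast
        refine ⟨j, hkj, fun j' hj' => ?_⟩
        have := ph_mono h (R.proc k) hj'
        have := hle j' (hkj.trans_le hj')
        omega
      · refine ⟨k + 1, k.lt_succ_self, fun j' hj' => ?_⟩
        have h1 := ph_mono h (R.proc k) hj'
        have h2 := hle j' hj'
        by_contra hne
        exact hlast ⟨j', hj', by omega⟩
    obtain ⟨l, hl, hlp, hla, hmaj⟩ := exists_majority h ht hc hj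
    have hkl := hkj.trans_le hl
    rcases hpend l hkl with ⟨h1, h2⟩ | ⟨m, -, h1, h2, h3⟩
    · have h3 := Commit.ph_succ h ⟨ho, hkl, hlp, hla, h1, hmaj, h2⟩
      rw [hj l hl, hj (l + 1) (hl.trans l.le_succ)] at h3
      omega
    · have h4 := hout l hkl hlp
      have : R.trace.out l = some (result R m o) := by
        refine trace_out.2 ⟨hla, ?_⟩
        change (regOut _ (state R l _)).2 = _
        rw [hlp, regOut, if_pos hmaj.lt, h2]
      rw [h4] at this
      cases this
  obtain ⟨h1, h2, h3⟩ := Nat.find_spec hex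
  obtain ⟨r, hr⟩ := Option.isSome_iff_exists.1 h3
  refine ⟨Nat.find hex, r, hk, h1, h2, hr, fun m hm hml hp => ?_⟩
  by_contra hne
  exact Nat.find_min hex hml ⟨hm, hp, Option.isSome_iff_ne_none.2 hne⟩

end

end Reg

end CAMP

/-! ### Linearization by tags. -/

namespace CAMP

/-- Operations can be listed in the order of their keys if each of them has only finitely many
predecessors. -/
theorem exists_listing {α : Type*} [LinearOrder α] (P : ℕ → Prop) (key : ℕ → α)
    (hinj : Function.Injective key) (hfin : ∀ k, P k → {j | P j ∧ key j < key k}.Finite) :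
    ∃ S : ℕ → Option ℕ, (∀ x k, S x = some k → P k) ∧ (∀ k, P k → ∃! x, S x = some k) ∧
      ∀ x x' k k', S x = some k → S x' = some k' → (key k < key k' ↔ x < x') := by
  -- An operation is placed in the slot given by the number of its predecessors.
  let rank : ℕ → ℕ := fun k => {j | P j ∧ key j < key k}.ncard
  have mono : ∀ k k', P k → P k' → key k < key k' → rank k < rank k' := by
    intro k k' hk hk' hlt
    refine Set.ncard_lt_ncard ⟨fun j hj => ⟨hj.1, hj.2.trans hlt⟩, fun hsub => ?_⟩ (hfin k' hk')
    exact lt_irrefl _ (hsub ⟨hk, hlt⟩).2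
  have mono' : ∀ k k', P k → P k' → (key k < key k' ↔ rank k < rank k') := by
    intro k k' hk hk'
    refine ⟨mono k k' hk hk', fun hlt => ?_⟩
    rcases lt_trichotomy (key k) (key k') with h | h | h
    · exact h
    · rw [hinj h] at hlt
      exact absurd hlt (lt_irrefl _)
    · exact absurd (mono k' k hk' hk h) hlt.asymm
  obtain ⟨S, hS⟩ := exists_sequence (fun x k => P k ∧ rank k = x) (by
    rintro x k k' ⟨hk, rfl⟩ ⟨hk', h⟩
    by_contra hne
    rcases lt_or_gt_of_ne (fun he => hne (hinj he) : key k ≠ key k') with hlt | hlt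
    · exact (mono k k' hk hk' hlt).ne h.symm
    · exact (mono k' k hk' hk hlt).ne h)
  refine ⟨S, fun x k hx => ((hS x k).1 hx).1,
    fun k hk => ⟨rank k, (hS _ _).2 ⟨hk, rfl⟩, fun y hy => ((hS y k).1 hy).2.symm⟩, ?_⟩
  intro x x' k k' hx hx'
  obtain ⟨hk, rfl⟩ := (hS x k).1 hx
  obtain ⟨hk', rfl⟩ := (hS x' k').1 hx'
  exact mono' k k' hk hk'

namespace Reg

open Gossip

variable {n t : ℕ} {V : Type} {v₀ : V} {R : Run (regGossip n v₀).alg}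

/-- The operation invoked in event `k` takes effect with tag `τ`. -/
def HasTag (R : Run (regGossip n v₀).alg) (k τ : ℕ) : Prop :=
  ∃ m o, Commit R k m o ∧ (state R (m + 1) (R.proc k)).tag = τ

def IsWrite (R : Run (regGossip n v₀).alg) (k : ℕ) : Prop := ∃ v, R.act k = .invoke (.write v)

/-- The operations that take effect: those that return, and the writes whose value is returned by
a read. -/
def InHist (R : Run (regGossip n v₀).alg) (k : ℕ) : Prop :=
  ∃ τ k' l' r', HasTag R k τ ∧ HasTag R k' τ ∧ R.trace.Returns k' l' r' ∧ (k = k' ∨ IsWrite R k)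

section

variable {allowed : Fin n → RegOp V → Prop} (h : R.IsExecution t allowed)
include h

theorem HasTag.unique {k τ τ' : ℕ} (hk : HasTag R k τ) (hk' : HasTag R k τ') : τ = τ' := by
  obtain ⟨m, o, hm, rfl⟩ := hk
  obtain ⟨m', o', hm', rfl⟩ := hk'
  rw [(Commit.unique h hm hm').1]

theorem hasTag_of_returns {k l : ℕ} {r : RegRes V} (hr : R.trace.Returns k l r) :
    ∃ τ, HasTag R k τ := by
  obtain ⟨m, o, -, hm, -⟩ := returns_spec h hr
  exact ⟨_, m, o, hm, rfl⟩

theorem Commit.tag_lt {k m : ℕ} {v : V} (hm : Commit R k m (.write v)) :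
    (state R m (R.proc k)).tag < (state R (m + 1) (R.proc k)).tag := by
  rw [(Commit.tag_write h hm).1]
  exact lt_newTag _ _

/-- Different writes have different tags. -/
theorem Commit.write_unique {k k' m m' : ℕ} {v v' : V} (hm : Commit R k m (.write v))
    (hm' : Commit R k' m' (.write v'))
    (he : (state R (m + 1) (R.proc k)).tag = (state R (m' + 1) (R.proc k')).tag) : k = k' := by
  -- The remainder modulo `n` reveals the writer, and the tags of one writer increase strictly.
  have hmod : ∀ {k m v}, Commit R k m (.write v) →
      (state R (m + 1) (R.proc k)).tag % n = R.proc k := by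
    intro k m v hm
    rw [(Commit.tag_write h hm).1, mul_comm, Nat.mul_add_mod, Nat.mod_eq_of_lt (R.proc k).isLt]
  have hp : R.proc k = R.proc k' := Fin.ext (by rw [← hmod hm, he, hmod hm'])
  rw [← hp] at he
  have key : ∀ {k k' m m' v v'}, Commit R k m (.write v) → Commit R k' m' (.write v') →
      R.proc k = R.proc k' → (state R (m + 1) (R.proc k)).tag =
        (state R (m' + 1) (R.proc k)).tag → ¬ m < m' := by
    intro k k' m m' v v' hm hm' hp he hlt
    have h1 := tag_mono h (R.proc k) (Nat.succ_le_of_lt hlt)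
    have h2 := Commit.tag_lt h hm'
    rw [← hp, ← he] at h2
    rw [Nat.succ_eq_add_one] at h1
    omega
  obtain rfl := le_antisymm (not_lt.1 (key hm' hm hp.symm (by rw [← hp, he])))
    (not_lt.1 (key hm hm' hp he))
  exact Commit.inv_unique h hm hm'

/-- Operations take effect with tags that respect their order in real time. -/
theorem tag_le_of_returns {k l k' τ τ' : ℕ} {r : RegRes V} (hr : R.trace.Returns k l r)
    (hk : HasTag R k τ) (hk' : HasTag R k' τ') (hlk : l < k') :
    τ ≤ τ' ∧ (IsWrite R k' → τ < τ') := by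
  obtain ⟨m, o, hml, hm, -, hmaj, hph⟩ := returns_spec h hr
  obtain rfl := HasTag.unique h hk ⟨m, o, hm, rfl⟩
  obtain ⟨m', o', hm', rfl⟩ := hk'
  -- The two phases to compare are the propagation phase of `k`, opened in event `m`, and the query
  -- phase of `k'`, opened in event `k'`.
  have h1 : (state R m (R.proc k)).ph < (state R l (R.proc k)).ph := by
    rw [hph, Commit.ph_succ h hm]
    exact Nat.lt_succ_self _
  have h2 : (state R k' (R.proc k')).ph < (state R m' (R.proc k')).ph := by
    rw [hm'.ph, state_invoke h hm'.inv]
    exact Nat.lt_succ_self _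
  have h3 := tag_le_of_majority h hmaj hm'.maj h1 h2 hlk.le
  refine ⟨h3.trans (tag_mono h _ m'.le_succ), ?_⟩
  rintro ⟨v, hv⟩
  rw [hm'.inv] at hv
  cases hv
  exact h3.trans_lt (Commit.tag_lt h hm')

/-- It recovers the invocation behind a query phase, so that every new tag can be attributed to a
`Commit`. -/
theorem exists_inv_of_query {k : ℕ} {p : Fin n} {o : RegOp V}
    (hk : (state R k p).mode = .query o) : ∃ j < k, R.act j = .invoke o ∧ R.proc j = p ∧
      (state R k p).ph = (state R (j + 1) p).ph := by
  refine invariant h (fun k p (x : RegState n V) => ∀ o, x.mode = .query o → ∃ j < k,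
    R.act j = .invoke o ∧ R.proc j = p ∧ x.ph = (state R (j + 1) p).ph) ?_ ?_ ?_ ?_ ?_ k p o hk
  · intro k p x hx o ho
    obtain ⟨j, hj, h1⟩ := hx o ho
    exact ⟨j, hj.trans k.lt_succ_self, h1⟩
  · intro p o ho
    cases ho
  · intro k o ho _ o' ho'
    cases ho'
    exact ⟨k, k.lt_succ_self, ho, rfl, by rw [state_invoke h ho]; rfl⟩
  · intro k s _ _ hx _ o ho
    obtain ⟨j, hj, h1⟩ := hx o ho
    exact ⟨j, hj.trans k.lt_succ_self, h1⟩
  · intro k ha hx o ho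
    have hs : (regOut (R.proc k) (state R k (R.proc k))).1 = state R k (R.proc k) := by
      change (regOut (R.proc k) (state R k (R.proc k))).1.mode = _ at ho
      unfold regOut at ho ⊢
      split_ifs at ho ⊢
      · revert ho
        split
        · exact fun _ => rfl
        · exact fun ho => by cases ho
        · exact fun ho => by cases ho
        · exact fun ho => by cases ho
      · rfl
    change (regOut (R.proc k) (state R k (R.proc k))).1.mode = _ at ho
    change ∃ j < k + 1, _ ∧ _ ∧ (regOut (R.proc k) (state R k (R.proc k))).1.ph = _
    rw [hs] at ho ⊢
    obtain ⟨j, hj, h1⟩ := hx o ho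
    exact ⟨j, hj.trans k.lt_succ_self, h1⟩

/-- A process has the initial value, or the tag and the value of some write. -/
theorem val_spec (k : ℕ) (p : Fin n) : (state R k p).tag = 0 ∧ (state R k p).val = v₀ ∨
    ∃ j m v, Commit R j m (.write v) ∧ (state R (m + 1) (R.proc j)).tag = (state R k p).tag ∧
      (state R k p).val = v := by
  refine invariant h (fun k p (x : RegState n V) => x.tag = 0 ∧ x.val = v₀ ∨
    ∃ j m v, Commit R j m (.write v) ∧ (state R (m + 1) (R.proc j)).tag = x.tag ∧ x.val = v)
    ?_ ?_ ?_ ?_ ?_ k p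
  · exact fun _ _ _ hx => hx
  · exact fun _ => .inl ⟨rfl, rfl⟩
  · exact fun _ _ _ hx => hx
  · intro k s _ _ hx hs
    by_cases hlt : (state R k (R.proc k)).tag < (state R s (R.proc s)).tag
    · have h1 : (regReceive (R.proc k) (state R k (R.proc k)) (R.proc s)
          (state R s (R.proc s))).tag = (state R s (R.proc s)).tag := max_eq_right hlt.le
      have h2 : (regReceive (R.proc k) (state R k (R.proc k)) (R.proc s)
          (state R s (R.proc s))).val = (state R s (R.proc s)).val := if_pos hlt
      exact hs.imp (fun hs => ⟨h1.trans hs.1, h2.trans hs.2⟩)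
        fun ⟨j, m, v, h3, h4, h5⟩ => ⟨j, m, v, h3, h4.trans h1.symm, h2.trans h5⟩
    · have h1 : (regReceive (R.proc k) (state R k (R.proc k)) (R.proc s)
          (state R s (R.proc s))).tag = (state R k (R.proc k)).tag := max_eq_left (not_lt.1 hlt)
      have h2 : (regReceive (R.proc k) (state R k (R.proc k)) (R.proc s)
          (state R s (R.proc s))).val = (state R k (R.proc k)).val := if_neg hlt
      exact hx.imp (fun hs => ⟨h1.trans hs.1, h2.trans hs.2⟩)
        fun ⟨j, m, v, h3, h4, h5⟩ => ⟨j, m, v, h3, h4.trans h1.symm, h2.trans h5⟩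
  · intro k ha hx
    -- Only the end of the query phase of a write creates a new tag.
    by_cases hw : Majority R k (R.proc k) ∧ ∃ v, (state R k (R.proc k)).mode = .query (.write v)
    · obtain ⟨hmaj, v, hv⟩ := hw
      obtain ⟨j, hj, h1, h2, h3⟩ := exists_inv_of_query h hv
      rw [← h2] at hmaj hv h3
      have hc : Commit R j k (.write v) := ⟨h1, hj, h2.symm, ha, hv, hmaj, h3⟩
      have hst := state_compute h ha
      refine .inr ⟨j, k, v, hc, ?_, ?_⟩
      · rw [h2, hst]
        rfl
      · have := (Commit.tag_write h hc).2
        rw [h2, hst] at this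
        exact this
    · have hs : (regOut (R.proc k) (state R k (R.proc k))).1.tag = (state R k (R.proc k)).tag ∧
          (regOut (R.proc k) (state R k (R.proc k))).1.val = (state R k (R.proc k)).val := by
        unfold regOut
        split_ifs with hmaj
        · split
          · exact ⟨rfl, rfl⟩
          · exact ⟨rfl, rfl⟩
          · next v hv => exact absurd ⟨hmaj, v, hv⟩ hw
          · exact ⟨rfl, rfl⟩
        · exact ⟨rfl, rfl⟩
      exact hx.imp (fun hx => ⟨hs.1.trans hx.1, hs.2.trans hx.2⟩)
        fun ⟨j, m, v, h3, h4, h5⟩ => ⟨j, m, v, h3, h4.trans hs.1.symm, hs.2.trans h5⟩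

/-- Operations are sorted by tag, then writes before reads, then by invocation. A read takes effect
with the tag of the write whose value it returns, so it comes after this write and before the next
one. -/
theorem atomicSpec : AtomicSpec v₀ R.trace := by
  classical
  -- Operations without a tag get the default 0, which is harmless since only operations of the
  -- history are sorted.
  obtain ⟨T, hT⟩ : ∃ T : ℕ → ℕ, ∀ k τ, HasTag R k τ → T k = τ := by
    obtain ⟨S, hS⟩ := exists_sequence (HasTag R) fun k τ τ' => HasTag.unique h
    exact ⟨fun k => (S k).getD 0, fun k τ hk => congrArg (fun x => x.getD 0) ((hS k τ).2 hk)⟩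
  let W : ℕ → ℕ := fun k => if IsWrite R k then 0 else 1
  have hW : ∀ {k}, IsWrite R k → W k = 0 := fun hk => if_pos hk
  have hW' : ∀ {k}, ¬ IsWrite R k → W k = 1 := fun hk => if_neg hk
  let key : ℕ → ℕ ×ₗ ℕ ×ₗ ℕ := fun k => toLex (T k, toLex (W k, k))
  have key_lt : ∀ {k k'}, key k < key k' ↔
      T k < T k' ∨ T k = T k' ∧ (W k < W k' ∨ W k = W k' ∧ k < k') := by
    intro k k'
    simp only [key, Prod.Lex.toLex_lt_toLex]
  have key_inj : Function.Injective key := fun k k' he =>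
    congrArg (fun x : ℕ ×ₗ ℕ ×ₗ ℕ => (ofLex (ofLex x).2).2) he
  -- This is why `InHist` asks for a returned operation `k₀` with the same tag. An operation invoked
  -- after `k₀` returned in event `l₀` and after event `k` is not sorted before `k`: if it is a
  -- write, its tag is larger, and a read with the same tag loses by its kind or its index.
  have hfin : ∀ k, InHist R k → {j | InHist R j ∧ key j < key k}.Finite := by
    rintro k ⟨τ, k₀, l₀, r₀, hk, hk₀, hr, hor⟩
    refine (Set.finite_Iic (max k l₀)).subset ?_
    rintro j ⟨⟨τ', -, -, -, hj, -⟩, hlt⟩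
    rw [Set.mem_Iic]
    by_contra hcon
    rw [not_le, max_lt_iff] at hcon
    obtain ⟨h1, h2⟩ := tag_le_of_returns h hr hk₀ hj hcon.2
    rw [key_lt, hT _ _ hk, hT _ _ hj] at hlt
    by_cases hwj : IsWrite R j
    · have := h2 hwj
      omega
    · rw [hW' hwj] at hlt
      have : W k ≤ 1 := by
        simp only [W]
        split_ifs <;> omega
      omega
  obtain ⟨S, hS1, hS2, hS3⟩ := exists_listing (InHist R) key key_inj hfin
  obtain ⟨H, hH⟩ := exists_sequence (fun k (a : Operation n (RegOp V) (RegRes V)) => InHist R k ∧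
    ∃ m o, Commit R k m o ∧ a = ⟨R.proc k, o, result R m o⟩) (by
      rintro k a a' ⟨-, m, o, hm, rfl⟩ ⟨-, m', o', hm', rfl⟩
      obtain ⟨rfl, rfl⟩ := Commit.unique h hm hm'
      rfl)
  refine ⟨H, ⟨?_, ?_⟩, S, ⟨?_, ?_, ?_⟩, ?_⟩
  · intro k a ha
    obtain ⟨-, m, o, hm, rfl⟩ := (hH k a).1 ha
    exact ⟨rfl, trace_inv.2 hm.inv⟩
  · intro k l r hr
    obtain ⟨m, o, -, hm, hres, -⟩ := returns_spec h hr
    exact ⟨_, (hH k _).2 ⟨⟨_, k, l, r, ⟨m, o, hm, rfl⟩, ⟨m, o, hm, rfl⟩, hr, .inl rfl⟩,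
      m, o, hm, rfl⟩, hres⟩
  · intro x k hx
    have hin := hS1 x k hx
    obtain ⟨τ, -, -, -, ⟨m, o, hm, -⟩, -⟩ := id hin
    exact Option.isSome_iff_exists.2 ⟨_, (hH k _).2 ⟨hin, m, o, hm, rfl⟩⟩
  · intro k hk
    obtain ⟨a, ha⟩ := Option.isSome_iff_exists.1 hk
    exact hS2 k ((hH k a).1 ha).1
  · rintro x x' k k' hx hx' ⟨l, r, hr, hl⟩
    rw [← hS3 x x' k k' hx hx', key_lt]
    obtain ⟨τ, hk⟩ := hasTag_of_returns h hr
    obtain ⟨τ', -, -, -, hk', -⟩ := hS1 x' k' hx'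
    obtain ⟨h1, h2⟩ := tag_le_of_returns h hr hk hk' hl
    rw [hT _ _ hk, hT _ _ hk']
    have h3 : k < k' := hr.2.1.trans hl
    by_cases hwk' : IsWrite R k'
    · exact .inl (h2 hwk')
    · rw [hW' hwk']
      have : W k ≤ 1 := by
        simp only [W]
        split_ifs <;> omega
      omega
  · intro x k a hx ha
    obtain ⟨hin, m, o, hm, rfl⟩ := (hH k a).1 ha
    cases o with
    | write v => trivial
    | read =>
      simp only [result]
      rw [hm.proc]
      have hTk := hT k _ ⟨m, _, hm, rfl⟩
      have hnw : ¬ IsWrite R k := by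
        rintro ⟨v, hv⟩
        rw [hm.inv] at hv
        cases hv
      have hwrite : ∀ {y a v}, (S y).bind H = some a → a.op = .write v → ∃ w mw, S y = some w ∧
          Commit R w mw (.write v) ∧ T w = (state R (mw + 1) (R.proc w)).tag := by
        intro y a v ha hav
        obtain ⟨w, hw, hwa⟩ := Option.bind_eq_some_iff.1 ha
        obtain ⟨-, mw, o, hmw, rfl⟩ := (hH w a).1 hwa
        obtain rfl : o = .write v := hav
        exact ⟨w, mw, hw, hmw, hT w _ ⟨mw, _, hmw, rfl⟩⟩
      rcases val_spec h (m + 1) (R.proc k) with ⟨h1, h2⟩ | ⟨j, mj, v, hj, h1, h2⟩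
      -- The tag of the read is 0, whereas writes have positive tags, so no write stands before it.
      · rw [h2]
        rcases regValue_spec v₀ H S x with ⟨h3, -⟩ | ⟨y, hy, b, hb, hbv, -⟩
        · exact h3.symm
        · obtain ⟨w, mw, hw, hmw, hTw⟩ := hwrite hb hbv
          have := (hS3 y x w k hw hx).2 hy
          rw [key_lt] at this
          have := Commit.tag_lt h hmw
          omega
      · have hTj := hT j _ ⟨mj, _, hj, rfl⟩
        have hwj : IsWrite R j := ⟨v, hj.inv⟩
        -- The write belongs to the history even if it never returned, because the read with its tag
        -- did.
        have hinj : InHist R j := by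
          obtain ⟨τ, k', l', r', hk, hk', hr, hor⟩ := hin
          obtain rfl := hor.resolve_right hnw
          exact ⟨_, k, l', r', ⟨mj, _, hj, h1⟩, ⟨m, _, hm, rfl⟩, hr, .inr hwj⟩
        obtain ⟨z, hz, -⟩ := hS2 j hinj
        have hzx : z < x := by
          rw [← hS3 z x j k hz hx, key_lt, hW hwj, hW' hnw]
          omega
        have hHj : (S z).bind H = some ⟨R.proc j, .write v, result R mj (.write v)⟩ := by
          rw [hz]
          exact (hH j _).2 ⟨hinj, mj, _, hj, rfl⟩
        rcases regValue_spec v₀ H S x with ⟨-, h3⟩ | ⟨y, hy, b, hb, hbv, h3⟩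
        · exact absurd rfl (h3 z hzx _ v hHj)
        -- The last write `w` before the read is not sorted before `j`, so its tag lies between two
        -- equal tags, and `w` is `j`.
        · obtain ⟨w, mw, hw, hmw, hTw⟩ := hwrite hb hbv
          have h4 := h3 z hzx _ v hHj rfl
          have h5 := (hS3 y x w k hw hx).2 hy
          rw [key_lt] at h5
          have h6 : ¬ key w < key j := by
            rw [hS3 y z w j hw hz]
            omega
          rw [key_lt] at h6
          obtain rfl := Commit.write_unique h hmw hj (by omega)
          have := (Commit.unique h hmw hj).2
          cases this
          rw [h2]

end

end Reg

theorem registerSolvable_atomic {V : Type} (v₀ : V) {n t : ℕ} (ht : 2 * t < n)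
    (writers : Set (Fin n)) : RegisterSolvable .atomic v₀ n t writers :=
  ⟨(regGossip n v₀).alg, fun _ h => ⟨Reg.terminates h ht, Reg.atomicSpec h⟩⟩

end CAMP

theorem mainTheorem3 :
    (∀ n t : ℕ, t < n → CAMP.MoneyTransferSolvable n t) ∧
    (∀ (V : Type) [Nontrivial V] (v₀ : V) (n t : ℕ), t < n →
      (∀ (κ : CAMP.RegisterKind) (w : Fin n),
        CAMP.RegisterSolvable κ v₀ n t {w} ↔ 2 * t < n) ∧
      (∀ writers : Set (Fin n), writers.Nonempty →
        (CAMP.RegisterSolvable .atomic v₀ n t writers ↔ 2 * t < n))) ∧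
    (∀ (V : Type) [Nontrivial V] (v₀ : V) (κ : CAMP.RegisterKind),
      CAMP.StrictlyWeaker CAMP.MoneyTransferSolvable
        (fun n t => ∃ w : Fin n, CAMP.RegisterSolvable κ v₀ n t {w})) := by
  have hmaj : ∀ (V : Type) [Nontrivial V] (v₀ : V) (n t : ℕ), t < n →
      ∀ (κ : CAMP.RegisterKind) (writers : Set (Fin n)), writers.Nonempty →
        CAMP.RegisterSolvable κ v₀ n t writers → 2 * t < n :=
    fun V _ v₀ n t ht κ writers ⟨w, hw⟩ hsol =>
      CAMP.two_mul_lt_of_solvable v₀ ht hw _ (fun T hT hs => CAMP.RegisterSpec.safe hs hT) hsol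
  refine ⟨fun n t => CAMP.moneyTransferSolvable, fun V _ v₀ n t ht => ⟨fun κ w => ⟨?_, ?_⟩,
    fun writers hw => ⟨hmaj V v₀ n t ht _ _ hw,
      fun h => CAMP.registerSolvable_atomic v₀ h writers⟩⟩, fun V _ v₀ κ => ⟨?_, 2, 1, ?_, ?_, ?_⟩⟩
  · exact hmaj V v₀ n t ht κ {w} ⟨w, rfl⟩
  · intro h
    -- One algorithm serves all three kinds, since the writes of a single writer are sequential.
    obtain ⟨A, hA⟩ := CAMP.registerSolvable_atomic v₀ h {w}
    exact ⟨A, fun R hR => ⟨(hA R hR).1,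
      CAMP.AtomicSpec.registerSpec (hA R hR).2 hR.properUse.writesSequential κ⟩⟩
  · exact fun n t ht _ => CAMP.moneyTransferSolvable ht
  · norm_num
  · exact CAMP.moneyTransferSolvable (by norm_num)
  · rintro ⟨w, hw⟩
    have := hmaj V v₀ 2 1 (by norm_num) κ {w} ⟨w, rfl⟩ hw
    omega
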